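/- Let $\mathsf Z(t)=\pi^{-it/2}\frac{\Gamma(1/4+it/2)}{|\Gamma(1/4+it/2)|}\zeta(\tfrac12+it)$ ($t\in\mathbb R$) be Hardy's function, which is real-valued, and let $\mathsf Z^{(n)}$ be its $n$-th derivative. For an integer $n\ge 0$ let $0\le t_0\le t_1\le\cdots$ be the non-negative zeros of $\mathsf Z^{(n)}$, repeated according to multiplicity, and put $$\Theta^{(n)}=\limsup_{k\to\infty}\frac{t_{k+1}-t_k}{2\pi/\log t_k}\in[0,\infty].$$ Let $l\ge 1$ and $n\ge 0$ be integers. Assume that for every integer $h$ with $0\le h\le l$ there is a constant $d_{h,l}=d_{h,l}(n+1,n)$ such that $$\frac1T\int_0^T|\mathsf Z^{(n+1)}(t)|^{2h}\,|\mathsf Z^{(n)}(t)|^{2l-2h}\,dt\sim d_{h,l}\,(\log T)^{l^2+2ln+2h},\qquad T\to\infty,$$ with $d_{l,l}\ne 0$, and put $B(h,l;n)=4^{h-l}\,d_{h,l}/d_{l,l}$ for $0\le h\le l$. Let $v_1,\dots,v_l$ be real numbers with $v_l=1$ such that $$G(u)=(2l-1)\sum_{h=1}^{l}\binom lh v_h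 u^{2h}$$ is strictly increasing on $[0,\infty)$. Then the equation $$\int_0^\infty\log\Bigl(1+\frac{G(u)}{(2l-1)\lambda}\Bigr)\frac{du}{u^2}=l\pi$$ has a unique root $\lambda>0$; with this $\lambda$ the equation $$\sum_{h=1}^{l}\frac{2l-1}{2h-1}\binom lh B(h,l;n)\,v_h\,\mathcal X^{h}=(2l-1)\,\lambda\,B(0,l;n)$$ has a unique positive real root $\mathcal X$; and $$\mathcal X\le(\Theta^{(n)})^2 .$$ This holds for every admissible choice of $v_1,\dots,v_{l-1}$, in particular for one that maximises $\mathcal X$. -/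

import Mathlib

open scoped ComplexConjugate

namespace HallGap

/-- The defining expression `π^{-it/2} Γ(1/4 + it/2) / |Γ(1/4 + it/2)| ζ(1/2 + it)` of Hardy's
function, as a complex number. -/
noncomputable def hardyZExpr (t : ℝ) : ℂ :=
  (Real.pi : ℂ) ^ (-(Complex.I * t / 2))
    * (Complex.Gamma (1 / 4 + Complex.I * t / 2) / ‖Complex.Gamma (1 / 4 + Complex.I * t / 2)‖)
    * riemannZeta (1 / 2 + Complex.I * t)

/-- Hardy's function `Z : ℝ → ℝ`. Its defining expression is a real number, see `ofReal_hardyZ`. -/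
noncomputable def hardyZ (t : ℝ) : ℝ := (hardyZExpr t).re

/-- The defining expression of Hardy's function is real, so nothing is lost in `hardyZ`. -/
theorem ofReal_hardyZ (t : ℝ) : ((hardyZ t : ℝ) : ℂ) = hardyZExpr t := by
  have hpi : (Real.pi : ℂ) ≠ 0 := by exact_mod_cast Real.pi_ne_zero
  set s : ℂ := 1 / 2 + Complex.I * t with hs
  have hs0 : s ≠ 0 := by
    intro h
    have := congrArg Complex.re h
    norm_num [hs] at this
  have hre : 0 < s.re := by norm_num [hs]
  have hG : Complex.Gammaℝ s ≠ 0 := Complex.Gammaℝ_ne_zero_of_re_pos hre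
  have hcs : conj s = 1 - s := by
    apply Complex.ext <;> norm_num [hs]
  have hLam : completedRiemannZeta s = Complex.Gammaℝ s * riemannZeta s := by
    rw [riemannZeta_def_of_ne_zero hs0]
    field_simp
  have hGc : Complex.Gammaℝ (conj s) = conj (Complex.Gammaℝ s) := by
    have harg : (Real.pi : ℂ).arg ≠ Real.pi := by
      rw [Complex.arg_ofReal_of_nonneg Real.pi_pos.le]
      exact Real.pi_pos.ne
    have h1 : -conj s / 2 = conj (-s / 2) := by rw [map_div₀, map_neg, Complex.conj_ofNat]
    have h2 : conj s / 2 = conj (s / 2) := by rw [map_div₀, Complex.conj_ofNat]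
    rw [Complex.Gammaℝ_def, Complex.Gammaℝ_def, map_mul, h1, h2, Complex.Gamma_conj,
      Complex.cpow_conj _ _ harg, Complex.conj_ofReal]
  have hs0' : conj s ≠ 0 := by simpa using hs0
  have hG' : Complex.Gammaℝ (conj s) ≠ 0 := by
    rw [hGc]; simpa using hG
  have hLamc : conj (completedRiemannZeta s) = completedRiemannZeta s := by
    have h1 : completedRiemannZeta (conj s) = Complex.Gammaℝ (conj s) * riemannZeta (conj s) := by
      rw [riemannZeta_def_of_ne_zero hs0']
      field_simp
    rw [hLam, map_mul, ← hGc, ← riemannZeta_conj, ← h1, hcs, completedRiemannZeta_one_sub, hLam]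
  have hpow : (Real.pi : ℂ) ^ (-(Complex.I * t / 2))
      = ((Real.pi ^ (1 / 4 : ℝ) : ℝ) : ℂ) * (Real.pi : ℂ) ^ (-s / 2) := by
    rw [Complex.ofReal_cpow Real.pi_pos.le, ← Complex.cpow_add _ _ hpi]
    congr 1
    rw [hs]; push_cast; ring
  have harg4 : (1 / 4 + Complex.I * t / 2 : ℂ) = s / 2 := by rw [hs]; ring
  have key : hardyZExpr t
      = ((Real.pi ^ (1 / 4 : ℝ) / ‖Complex.Gamma (s / 2)‖ : ℝ) : ℂ) * completedRiemannZeta s := by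
    rw [hardyZExpr, harg4, hpow, ← hs, hLam, Complex.Gammaℝ_def]
    push_cast
    ring
  rw [hardyZ]
  apply Complex.conj_eq_iff_re.mp
  rw [key, map_mul, hLamc, Complex.conj_ofReal]

/-- The `n`-th derivative `Z^{(n)}` of Hardy's function. -/
noncomputable def hardyZDeriv (n : ℕ) : ℝ → ℝ := iteratedDeriv n hardyZ

/-- The number of zeros of `f` in `[0, x]`, a zero of order `r` being counted `r` times
(the pairs `(z, 0), …, (z, r - 1)`). -/
noncomputable def zeroCount (f : ℝ → ℝ) (x : ℝ) : ℕ∞ :=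
  {p : ℝ × ℕ | 0 ≤ p.1 ∧ p.1 ≤ x ∧ (p.2 : ℕ∞) < analyticOrderAt f p.1}.encard

/-- The non-negative zeros `t₀ ≤ t₁ ≤ t₂ ≤ …` of `f`, in increasing order and repeated according
to multiplicity: `t_k` is the least `x` such that `[0, x]` contains at least `k + 1` zeros. -/
noncomputable def zeroSeq (f : ℝ → ℝ) (k : ℕ) : ℝ :=
  sInf {x : ℝ | (k : ℕ∞) < zeroCount f x}

open Classical in
/-- `Θ^{(n)} = limsup_k (t_{k+1} - t_k) / (2π / log t_k)`, where `t_k` runs through the non-negative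
zeros of `Z^{(n)}`, as an extended real number. The limsup presupposes that `Z^{(n)}` has infinitely
many non-negative zeros; the value `⊤` in the other case (the last gap would be infinite) only
makes the definition total. -/
noncomputable def theta (n : ℕ) : EReal :=
  if {t : ℝ | 0 ≤ t ∧ hardyZDeriv n t = 0}.Infinite then
    Filter.limsup (fun k : ℕ =>
      (((zeroSeq (hardyZDeriv n) (k + 1) - zeroSeq (hardyZDeriv n) k)
        / (2 * Real.pi / Real.log (zeroSeq (hardyZDeriv n) k)) : ℝ) : EReal)) Filter.atTop
  else ⊤

/-- `(1/T) ∫₀ᵀ |Z^{(n+1)}(t)|^{2h} |Z^{(n)}(t)|^{2l-2h} dt`, for `h ≤ l`. -/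
noncomputable def jointMoment (l h n : ℕ) (T : ℝ) : ℝ :=
  (1 / T) * ∫ t in (0 : ℝ)..T,
    |hardyZDeriv (n + 1) t| ^ (2 * h) * |hardyZDeriv n t| ^ (2 * l - 2 * h)

/-- The constant `d` is the leading coefficient in
`(1/T) ∫₀ᵀ |Z^{(n+1)}|^{2h} |Z^{(n)}|^{2l-2h} dt ∼ d (log T)^{l² + 2ln + 2h}`, `T → ∞`. -/
def IsLeadingCoeff (l h n : ℕ) (d : ℝ) : Prop :=
  Asymptotics.IsEquivalent Filter.atTop (jointMoment l h n)
    (fun T : ℝ => d * Real.log T ^ (l ^ 2 + 2 * l * n + 2 * h))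

/-- `B(h,l;n) = 4^{h-l} d_{h,l} / d_{l,l}`, where `d h` stands for `d_{h,l}(n+1,n)`. -/
noncomputable def ratioB (l : ℕ) (d : ℕ → ℝ) (h : ℕ) : ℝ :=
  (4 : ℝ) ^ ((h : ℤ) - (l : ℤ)) * (d h / d l)

/-- `G(u) = (2l-1) ∑_{h=1}^l binom(l,h) v_h u^{2h}`. -/
noncomputable def G (l : ℕ) (v : ℕ → ℝ) (u : ℝ) : ℝ :=
  (2 * (l : ℝ) - 1) * ∑ h ∈ Finset.Icc 1 l, (l.choose h : ℝ) * v h * u ^ (2 * h)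

/-- `lam` is a root of `∫₀^∞ log (1 + G(u) / ((2l-1) lam)) du / u² = l π`; the logarithm asks for
`lam > 0`. (The right-hand side is nonzero for `l ≥ 1`, so the equation includes that the integrand
is integrable.) -/
def IsLambda (l : ℕ) (v : ℕ → ℝ) (lam : ℝ) : Prop :=
  0 < lam ∧
    ∫ u in Set.Ioi (0 : ℝ), Real.log (1 + G l v u / ((2 * (l : ℝ) - 1) * lam)) / u ^ 2
      = l * Real.pi

/-- `X` is a positive real root of
`∑_{h=1}^l (2l-1)/(2h-1) binom(l,h) B(h,l;n) v_h X^h = (2l-1) lam B(0,l;n)`. -/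
def IsPosRoot (l : ℕ) (d v : ℕ → ℝ) (lam X : ℝ) : Prop :=
  0 < X ∧
    ∑ h ∈ Finset.Icc 1 l,
        (2 * (l : ℝ) - 1) / (2 * (h : ℝ) - 1) * (l.choose h : ℝ) * ratioB l d h * v h * X ^ h
      = (2 * (l : ℝ) - 1) * lam * ratioB l d 0

end HallGap

namespace HallGap

open Filter Topology Set MeasureTheory

/-! Write `φ` for the even polynomial `lagr`, so that `G u = u φ'(u) - φ(u)` is its Hamiltonian, and
put `C = (2l-1)λ`. Since `G' = u φ''`, the monotonicity of `G` makes `φ` strictly convex. The core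
is a sharp Wirtinger inequality for the form `E(z, y) = y^(2l) φ(z/y)` (`energy`): if `f` vanishes
at both ends of an interval shorter than `πκ`, then `C ∫ f^(2l) ≤ ∫ E(κ f', f)`
(`wirtinger_energy`).

It is proved by calibration. With `p = φ'(m)`, the ODE `p' = -2l (G(m) + C)` and the tangent
inequality for `φ` give `p'/(2l) + p u ≤ φ(u) - C` for all `u`; so `p f^(2l)`, rescaled by `κ`, has
derivative at most `E - C f^(2l)` and vanishes at both ends. A solution with `p(0) = 0` needs time
`∫ dp / (G + C)`, up to the factor `2l`, to run off to infinity. Substituting `p = φ'(u)` and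
integrating by parts turns this into `∫ log(1 + G/C) du/u²`. The equation for `λ` sets it to `lπ`,
so `p` exists on every interval shorter than `π`.

Now let `K > Θ`. All late gaps satisfy `t_{k+1} - t_k < 2πK / log t_k`. For `t_k ≥ T / log T` this
is at most `πκ` with `κ = 2K / log(T / log T)`. Summing the inequality over these gaps, dividing by
`T (log T)^(l² + 2ln)` and letting `T → ∞` along the zeros gives `C d_0 ≤ Σ coef_h (2K)^(2h) d_h`
(`le_energyLimit_of_gaps`). The right side is `4^l d_l P(K²)`, where `P` is the polynomial of the
equation for `𝒳`, and that equation says `4^l d_l P(𝒳) = C d_0`. Hence `P(𝒳) ≤ P(K²)`; as `P` is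
strictly increasing, `𝒳 ≤ K²`, and `K ↓ Θ` finishes the proof. -/

/-- A sum of powers with a positive coefficient at the dominating exponent tends to `∞`. -/
theorem tendsto_sum_mul_pow_atTop {l : ℕ} (hl : 1 ≤ l) (a : ℕ → ℝ) (e : ℕ → ℕ) (ha : 0 < a l)
    (he : ∀ h ∈ Finset.Icc 1 l, h ≠ l → e h < e l) (hel : e l ≠ 0) :
    Tendsto (fun u : ℝ => ∑ h ∈ Finset.Icc 1 l, a h * u ^ e h) atTop atTop := by
  have hmem : l ∈ Finset.Icc 1 l := Finset.mem_Icc.2 ⟨hl, le_rfl⟩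
  have h1 : Tendsto (fun u : ℝ => ∑ h ∈ Finset.Icc 1 l, a h * (u ^ e h / u ^ e l)) atTop
      (𝓝 (∑ h ∈ Finset.Icc 1 l, if h = l then a l else 0)) := by
    refine tendsto_finsetSum _ fun h hh => ?_
    split_ifs with hhl
    · subst hhl
      refine tendsto_const_nhds.congr' ?_
      filter_upwards [eventually_gt_atTop 0] with u hu
      rw [div_self (pow_pos hu _).ne', mul_one]
    · simpa using (tendsto_pow_div_pow_atTop_zero (𝕜 := ℝ) (he h hh hhl)).const_mul (a h)
  rw [Finset.sum_ite_eq' , if_pos hmem] at h1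
  refine (h1.pos_mul_atTop ha (tendsto_pow_atTop hel)).congr' ?_
  filter_upwards [eventually_gt_atTop 0] with u hu
  rw [Finset.sum_mul]
  refine Finset.sum_congr rfl fun h _ => ?_
  have := (pow_pos hu (e l)).ne'
  field_simp

/-! ### Lagrangian, momentum and convexity -/

/-- The coefficients of the Lagrangian belonging to the Hamiltonian `G`. -/
noncomputable def coef (l : ℕ) (v : ℕ → ℝ) (h : ℕ) : ℝ :=
  (2 * (l : ℝ) - 1) / (2 * (h : ℝ) - 1) * (l.choose h : ℝ) * v h

/-- The Lagrangian `φ`, with `G u = u φ'(u) - φ(u)`. -/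
noncomputable def lagr (l : ℕ) (v : ℕ → ℝ) (u : ℝ) : ℝ :=
  ∑ h ∈ Finset.Icc 1 l, coef l v h * u ^ (2 * h)

/-- The derivative of the Lagrangian. -/
noncomputable def mom (l : ℕ) (v : ℕ → ℝ) (u : ℝ) : ℝ :=
  ∑ h ∈ Finset.Icc 1 l, coef l v h * (2 * h) * u ^ (2 * h - 1)

variable {l : ℕ} {v : ℕ → ℝ}

theorem coef_self (hl : 1 ≤ l) (hv : v l = 1) : coef l v l = 1 := by
  have : (1 : ℝ) ≤ l := by exact_mod_cast hl
  have h2 : 2 * (l : ℝ) - 1 ≠ 0 := by linarith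
  simp [coef, hv, div_self h2]

theorem hasDerivAt_lagr (u : ℝ) : HasDerivAt (lagr l v) (mom l v u) u := by
  unfold lagr mom
  refine HasDerivAt.fun_sum fun h _ => ?_
  have := (hasDerivAt_pow (2 * h) u).const_mul (coef l v h)
  refine this.congr_deriv ?_
  push_cast
  ring

theorem differentiable_mom : Differentiable ℝ (mom l v) := by
  unfold mom
  fun_prop

theorem continuous_mom : Continuous (mom l v) := differentiable_mom.continuous

theorem lagr_zero : lagr l v 0 = 0 := by
  refine Finset.sum_eq_zero fun h hh => ?_
  have := (Finset.mem_Icc.1 hh).1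
  rw [zero_pow (by omega), mul_zero]

theorem G_zero : G l v 0 = 0 := by
  unfold G
  rw [Finset.sum_eq_zero, mul_zero]
  intro h hh
  have := (Finset.mem_Icc.1 hh).1
  rw [zero_pow (by omega), mul_zero]

theorem G_neg (u : ℝ) : G l v (-u) = G l v u := by
  simp [G, pow_mul]

theorem mom_neg (u : ℝ) : mom l v (-u) = -mom l v u := by
  unfold mom
  rw [← Finset.sum_neg_distrib]
  refine Finset.sum_congr rfl fun h hh => ?_
  have := (Finset.mem_Icc.1 hh).1
  rw [Odd.neg_pow ⟨h - 1, by omega⟩]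
  ring

theorem mom_zero : mom l v 0 = 0 := by
  have := mom_neg (l := l) (v := v) 0
  rw [neg_zero] at this
  linarith

theorem G_eq (u : ℝ) : G l v u = u * mom l v u - lagr l v u := by
  unfold G mom lagr
  rw [Finset.mul_sum, Finset.mul_sum, ← Finset.sum_sub_distrib]
  refine Finset.sum_congr rfl fun h hh => ?_
  have h1 := (Finset.mem_Icc.1 hh).1
  have h1' : (1 : ℝ) ≤ h := by exact_mod_cast h1
  have h2 : 2 * (h : ℝ) - 1 ≠ 0 := by linarith
  have h3 : u ^ (2 * h) = u * u ^ (2 * h - 1) := by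
    rw [← pow_succ']; congr 1; omega
  rw [h3, coef]
  field_simp

theorem continuous_G : Continuous (G l v) := by
  unfold G
  fun_prop

/-- The terms `φ'` in the derivative of `u φ' - φ` cancel, so the sign of `G'` on `u > 0` is that of
`φ''`. -/
theorem hasDerivAt_G (u : ℝ) : HasDerivAt (G l v) (u * deriv (mom l v) u) u := by
  have h := ((hasDerivAt_id u).mul (differentiable_mom (l := l) (v := v) u).hasDerivAt).sub
    (hasDerivAt_lagr (l := l) (v := v) u)
  have h' := h.congr_of_eventuallyEq (f₁ := G l v) (Eventually.of_forall fun x => G_eq x)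
  refine h'.congr_deriv ?_
  simp

theorem surjective_mom (hl : 1 ≤ l) (hv : v l = 1) : Function.Surjective (mom l v) := by
  have htop : Tendsto (mom l v) atTop atTop := by
    refine tendsto_sum_mul_pow_atTop hl (fun h => coef l v h * (2 * h)) (fun h => 2 * h - 1) ?_ ?_ ?_
    · simp only [coef_self hl hv]
      positivity
    · intro h hh hne
      have := Finset.mem_Icc.1 hh
      omega
    · omega
  refine continuous_mom.surjective htop ?_
  have h := tendsto_neg_atTop_atBot.comp (htop.comp tendsto_neg_atBot_atTop)
  refine h.congr fun u => ?_
  simp [mom_neg]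

section

variable (hG : StrictMonoOn (G l v) (Ici 0))
include hG

theorem G_nonneg (u : ℝ) : 0 ≤ G l v u := by
  have key : ∀ u : ℝ, 0 ≤ u → 0 ≤ G l v u := fun u hu => by
    have := hG.monotoneOn (mem_Ici.2 le_rfl) (mem_Ici.2 hu) hu
    rwa [G_zero] at this
  rcases le_total 0 u with h | h
  · exact key u h
  · rw [← G_neg]
    exact key _ (by linarith)

theorem G_pos {u : ℝ} (hu : 0 < u) : 0 < G l v u := by
  have := hG (mem_Ici.2 le_rfl) (mem_Ici.2 hu.le) hu
  rwa [G_zero] at this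

theorem strictMono_mom : StrictMono (mom l v) := by
  refine strictMono_of_odd_strictMonoOn_nonneg mom_neg ?_
  have hmono : MonotoneOn (mom l v) (Ici 0) := by
    refine monotoneOn_of_deriv_nonneg (convex_Ici 0) continuous_mom.continuousOn
      differentiable_mom.differentiableOn fun x hx => ?_
    rw [interior_Ici, mem_Ioi] at hx
    have h1 : 0 ≤ derivWithin (G l v) (Ici 0) x := hG.monotoneOn.derivWithin_nonneg
    rw [derivWithin_of_mem_nhds (Ici_mem_nhds hx), (hasDerivAt_G x).deriv] at h1
    exact nonneg_of_mul_nonneg_right h1 hx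
  intro a ha b hb hab
  -- If `φ'` agreed at `a < b`, it would also take that value at the mean value point `c`, so `φ(b)
  -- - φ(a) = φ'(a)(b - a)`. Then `G a = G b`, against strict monotonicity.
  refine lt_of_le_of_ne (hmono ha hb hab.le) fun heq => ?_
  obtain ⟨c, hc, hc'⟩ := exists_hasDerivAt_eq_slope (lagr l v) (mom l v) hab
    (fun x _ => (hasDerivAt_lagr x).continuousAt.continuousWithinAt)
    (fun x _ => hasDerivAt_lagr x)
  have hc0 : c ∈ Ici (0 : ℝ) := le_trans ha hc.1.le
  have h1 := hmono ha hc0 hc.1.le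
  have h2 := hmono hc0 hb hc.2.le
  have h3 : mom l v c = mom l v a := by linarith
  rw [h3, eq_div_iff (by linarith)] at hc'
  have h4 := hG ha hb hab
  rw [G_eq, G_eq, ← heq] at h4
  nlinarith

/-- The Lagrangian lies above its tangents. -/
theorem lagr_ge_tangent (m u : ℝ) : lagr l v m + mom l v m * (u - m) ≤ lagr l v u := by
  have hm := (strictMono_mom hG).monotone
  rcases lt_trichotomy m u with h | rfl | h
  · obtain ⟨c, hc, hc'⟩ := exists_hasDerivAt_eq_slope (lagr l v) (mom l v) h
      (fun x _ => (hasDerivAt_lagr x).continuousAt.continuousWithinAt)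
      (fun x _ => hasDerivAt_lagr x)
    rw [eq_div_iff (by linarith)] at hc'
    nlinarith [hm hc.1.le]
  · simp
  · obtain ⟨c, hc, hc'⟩ := exists_hasDerivAt_eq_slope (lagr l v) (mom l v) h
      (fun x _ => (hasDerivAt_lagr x).continuousAt.continuousWithinAt)
      (fun x _ => hasDerivAt_lagr x)
    rw [eq_div_iff (by linarith)] at hc'
    nlinarith [hm hc.2.le]

theorem monotoneOn_lagr : MonotoneOn (lagr l v) (Ici 0) := by
  intro a ha b hb hab
  have h0 : 0 ≤ mom l v a := by
    rw [← mom_zero (l := l) (v := v)]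
    exact (strictMono_mom hG).monotone ha
  have := lagr_ge_tangent hG a b
  nlinarith

theorem lagr_nonneg (u : ℝ) : 0 ≤ lagr l v u := by
  have := lagr_ge_tangent hG 0 u
  rwa [lagr_zero, mom_zero, zero_mul, add_zero] at this

end

theorem two_mul_sub_one_pos (hl : 1 ≤ l) : (0 : ℝ) < 2 * l - 1 := by
  have : (1 : ℝ) ≤ l := by exact_mod_cast hl
  linarith

/-! ### Travelling time and calibration -/

/-- The inverse of the momentum map. -/
noncomputable def momInv (l : ℕ) (v : ℕ → ℝ) : ℝ → ℝ := Function.invFun (mom l v)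

theorem mom_momInv (hl : 1 ≤ l) (hv : v l = 1) (p : ℝ) : mom l v (momInv l v p) = p :=
  Function.invFun_eq (surjective_mom hl hv p)

section

variable (hG : StrictMonoOn (G l v) (Ici 0))
include hG

theorem momInv_mom (u : ℝ) : momInv l v (mom l v u) = u :=
  Function.leftInverse_invFun (strictMono_mom hG).injective u

theorem continuous_momInv (hl : 1 ≤ l) (hv : v l = 1) : Continuous (momInv l v) := by
  have hmono : Monotone (momInv l v) := fun a b hab => by
    rw [← (strictMono_mom hG).le_iff_le, mom_momInv hl hv, mom_momInv hl hv]
    exact hab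
  exact hmono.continuous_of_surjective fun u => ⟨mom l v u, momInv_mom hG u⟩

theorem momInv_neg (hl : 1 ≤ l) (hv : v l = 1) (p : ℝ) : momInv l v (-p) = -momInv l v p := by
  apply (strictMono_mom hG).injective
  rw [mom_momInv hl hv, mom_neg, mom_momInv hl hv]

end

/-- The travelling time of the Hamiltonian flow as a function of the momentum. -/
noncomputable def travelTime (l : ℕ) (v : ℕ → ℝ) (C p : ℝ) : ℝ :=
  ∫ q in (0 : ℝ)..p, (G l v (momInv l v q) + C)⁻¹

section

variable {C : ℝ}

/-- Because `G(0) = G'(0) = 0`, the boundary term at the lower end of the integration by parts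
disappears in the limit. -/
theorem tendsto_G_div : Tendsto (fun ε : ℝ => G l v ε / (C * ε)) (𝓝[>] 0) (𝓝 0) := by
  have h := (hasDerivAt_iff_tendsto_slope.1 (hasDerivAt_G (l := l) (v := v) 0)).mono_left
    (nhdsWithin_mono (0 : ℝ) (fun x (hx : x ∈ Ioi (0 : ℝ)) => (ne_of_gt hx : x ≠ 0)))
  rw [zero_mul] at h
  have h2 := h.div_const C
  rw [zero_div] at h2
  refine h2.congr fun x => ?_
  rw [slope_def_field, G_zero, sub_zero, sub_zero, div_div, mul_comm]

variable (hG : StrictMonoOn (G l v) (Ici 0))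
include hG

theorem hamiltonian_pos (hC : 0 < C) (p : ℝ) : 0 < G l v (momInv l v p) + C := by
  have := G_nonneg hG (momInv l v p)
  linarith

variable (hl : 1 ≤ l) (hv : v l = 1)
include hl hv

theorem travelTime_neg (p : ℝ) : travelTime l v C (-p) = -travelTime l v C p := by
  unfold travelTime
  have h := intervalIntegral.integral_comp_neg (a := -p) (b := 0)
    (fun q => (G l v (momInv l v q) + C)⁻¹)
  rw [neg_neg, neg_zero] at h
  rw [← h, intervalIntegral.integral_symm]
  simp only [momInv_neg hG hl hv, G_neg]

variable (hC : 0 < C)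
include hC

theorem continuous_rate : Continuous fun p => (G l v (momInv l v p) + C)⁻¹ :=
  ((continuous_G.comp (continuous_momInv hG hl hv)).add continuous_const).inv₀
    fun p => (hamiltonian_pos hG hC p).ne'

theorem hasDerivAt_travelTime (p : ℝ) :
    HasDerivAt (travelTime l v C) (G l v (momInv l v p) + C)⁻¹ p :=
  (continuous_rate hG hl hv hC).integral_hasStrictDerivAt 0 p |>.hasDerivAt

theorem strictMono_travelTime : StrictMono (travelTime l v C) :=
  strictMono_of_hasDerivAt_pos (hasDerivAt_travelTime hG hl hv hC)
    fun p => inv_pos.2 (hamiltonian_pos hG hC p)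

theorem continuous_travelTime : Continuous (travelTime l v C) :=
  continuous_iff_continuousAt.2 fun p => (hasDerivAt_travelTime hG hl hv hC p).continuousAt

/-- Integration by parts: the travelling time bounds the integral of the logarithmic kernel. -/
theorem le_travelTime {ε M : ℝ} (hε : 0 < ε) (hεM : ε ≤ M) :
    (∫ u in ε..M, Real.log (1 + G l v u / C) / u ^ 2) - G l v ε / (C * ε)
      ≤ travelTime l v C (mom l v M) := by
  -- In the derivative of `D` the two terms `φ''/(G + C)` cancel, so `D` is a primitive of the
  -- kernel. Of the four boundary terms, two have a favourable sign and the one at `ε` is bounded by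
  -- `log(1 + x) ≤ x`.
  set D : ℝ → ℝ := fun u => travelTime l v C (mom l v u) - Real.log (1 + G l v u / C) / u with hD
  have hpos : ∀ u, 0 < 1 + G l v u / C := fun u => by
    have := div_nonneg (G_nonneg hG u) hC.le
    linarith
  have hderiv : ∀ u ∈ uIcc ε M, HasDerivAt D (Real.log (1 + G l v u / C) / u ^ 2) u := by
    intro u hu
    rw [uIcc_of_le hεM] at hu
    have hu0 : 0 < u := hε.trans_le hu.1
    have h1 := (hasDerivAt_travelTime hG hl hv hC (mom l v u)).comp u
      (differentiable_mom (l := l) (v := v) u).hasDerivAt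
    rw [momInv_mom hG] at h1
    have h2 := ((((hasDerivAt_G (l := l) (v := v) u).div_const C).const_add 1).log
      (hpos u).ne').div (hasDerivAt_id u) hu0.ne'
    refine (h1.sub h2).congr_deriv ?_
    have h3 := (hpos u).ne'
    have h4 : G l v u + C ≠ 0 := by
      have := G_nonneg hG u
      linarith
    have h5 : 1 + G l v u / C = (G l v u + C) / C := by
      field_simp
      ring
    simp only [id]
    generalize Real.log (1 + G l v u / C) = L
    rw [h5]
    field_simp
    ring
  have hcont : ContinuousOn (fun u => Real.log (1 + G l v u / C) / u ^ 2) (uIcc ε M) := by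
    intro u hu
    rw [uIcc_of_le hεM] at hu
    have hu0 : 0 < u := hε.trans_le hu.1
    have : ContinuousAt (fun u => Real.log (1 + G l v u / C) / u ^ 2) u :=
      ((continuousAt_const.add (continuous_G.continuousAt.div_const C)).log (hpos u).ne').div
        (continuousAt_id.pow 2) (by positivity)
    exact this.continuousWithinAt
  rw [intervalIntegral.integral_eq_sub_of_hasDerivAt hderiv hcont.intervalIntegrable]
  have h1 : 0 ≤ travelTime l v C (mom l v ε) := by
    have : travelTime l v C 0 = 0 := by simp [travelTime]
    rw [← this]
    refine (strictMono_travelTime hG hl hv hC).monotone ?_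
    rw [← mom_zero (l := l) (v := v)]
    exact (strictMono_mom hG).monotone hε.le
  have h2 : Real.log (1 + G l v ε / C) / ε ≤ G l v ε / (C * ε) := by
    rw [← div_div]
    gcongr
    have := Real.log_le_sub_one_of_pos (hpos ε)
    linarith
  have h3 : 0 ≤ Real.log (1 + G l v M / C) / M := by
    refine div_nonneg (Real.log_nonneg ?_) (hε.le.trans hεM)
    have := div_nonneg (G_nonneg hG M) hC.le
    linarith
  simp only [hD]
  linarith

/-- The travelling time exceeds every number below the integral of the logarithmic kernel. -/
theorem exists_lt_travelTime {s : ℝ} (hs0 : 0 ≤ s)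
    (hs : s < ∫ u in Ioi (0 : ℝ), Real.log (1 + G l v u / C) / u ^ 2) :
    ∃ p, 0 < p ∧ s < travelTime l v C p := by
  -- A non-integrable kernel would have integral `0` by convention, which contradicts `0 ≤ s`.
  have hint : IntegrableOn (fun u => Real.log (1 + G l v u / C) / u ^ 2) (Ioi (0 : ℝ)) := by
    by_contra h
    rw [integral_undef h] at hs
    linarith
  have ha : Tendsto (fun k : ℕ => 1 / ((k : ℝ) + 1)) atTop (𝓝[>] 0) :=
    tendsto_nhdsWithin_iff.2 ⟨tendsto_one_div_add_atTop_nhds_zero_nat,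
      Eventually.of_forall fun k => by simp only [mem_Ioi]; positivity⟩
  have hb : Tendsto (fun k : ℕ => (k : ℝ) + 1) atTop atTop :=
    tendsto_atTop_add_const_right _ _ tendsto_natCast_atTop_atTop
  have hcov : AECover (volume.restrict (Ioi (0 : ℝ))) atTop
      (fun k : ℕ => Ioc (1 / ((k : ℝ) + 1)) ((k : ℝ) + 1)) :=
    (aecover_Ioi_of_Ioi (tendsto_nhdsWithin_iff.1 ha).1).inter (aecover_Iic hb).restrict
  have h1 := hcov.integral_tendsto_of_countably_generated hint
  have h2 := (tendsto_G_div (l := l) (v := v) (C := C)).comp ha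
  have h3 := h1.sub h2
  rw [sub_zero] at h3
  obtain ⟨k, hk⟩ := ((tendsto_order.1 h3).1 s hs).exists
  have hk1 : (1 : ℝ) ≤ k + 1 := by
    have : (0 : ℝ) ≤ k := k.cast_nonneg
    linarith
  have hpos : (0 : ℝ) < k + 1 := by linarith
  have hle : 1 / ((k : ℝ) + 1) ≤ k + 1 := by
    rw [div_le_iff₀ hpos]
    nlinarith
  have hk2 := le_travelTime hG hl hv hC (by positivity : (0 : ℝ) < 1 / ((k : ℝ) + 1)) hle
  refine ⟨mom l v (k + 1), ?_, hk.trans_le ?_⟩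
  · rw [← mom_zero (l := l) (v := v)]
    exact strictMono_mom hG hpos
  · refine le_trans (le_of_eq ?_) hk2
    rw [intervalIntegral.integral_of_le hle, Function.comp_apply,
      Measure.restrict_restrict measurableSet_Ioc, inter_eq_left.2]
    intro x hx
    exact lt_trans (by positivity) hx.1

/-- A calibration: a solution `p` of the Hamilton–Jacobi inequality on an interval whose length is
smaller than the critical one. -/
theorem exists_calibration {s : ℝ} (hs0 : 0 ≤ s)
    (hs : s < ∫ u in Ioi (0 : ℝ), Real.log (1 + G l v u / C) / u ^ 2) :
    ∃ p p' : ℝ → ℝ, ∀ x ∈ Icc (-s / (2 * l)) (s / (2 * l)), HasDerivAt p (p' x) x ∧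
      ∀ u, p' x / (2 * l) + p x * u ≤ lagr l v u - C := by
  obtain ⟨P, hP0, hP⟩ := exists_lt_travelTime hG hl hv hC hs0 hs
  have hmono := strictMono_travelTime hG hl hv hC
  set A := travelTime l v C with hA
  set B := Function.invFun A with hB
  have hBA : ∀ p, B (A p) = p := Function.leftInverse_invFun hmono.injective
  -- The range of `A` may be bounded, so `B` is only used as a two-sided inverse on `(-A P, A P)`.
  have hsurj : ∀ y ∈ Ioo (-A P) (A P), ∃ p ∈ Icc (-P) P, A p = y := by
    intro y hy
    have h := intermediate_value_Icc (by linarith : -P ≤ P)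
      (continuous_travelTime hG hl hv hC).continuousOn
    rw [travelTime_neg hG hl hv] at h
    exact h ⟨hy.1.le, hy.2.le⟩
  have hAB : ∀ y ∈ Ioo (-A P) (A P), A (B y) = y := by
    intro y hy
    obtain ⟨p, -, rfl⟩ := hsurj y hy
    rw [hBA]
  have hBmono : MonotoneOn B (Ioo (-A P) (A P)) := by
    intro y hy z hz hyz
    rw [← hmono.le_iff_le, hAB y hy, hAB z hz]
    exact hyz
  have hderiv : ∀ y ∈ Ioo (-A P) (A P), HasDerivAt B (G l v (momInv l v (B y)) + C) y := by
    intro y hy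
    have hnhds : Ioo (-A P) (A P) ∈ 𝓝 y := Ioo_mem_nhds hy.1 hy.2
    have hBy : B y ∈ Ioo (-P) P := by
      rw [mem_Ioo, ← hmono.lt_iff_lt, ← hmono.lt_iff_lt (a := B y), hAB y hy, hA,
        travelTime_neg hG hl hv]
      exact hy
    have himg : B '' Ioo (-A P) (A P) ∈ 𝓝 (B y) := by
      refine mem_of_superset (Ioo_mem_nhds hBy.1 hBy.2) fun p hp => ⟨A p, ⟨?_, hmono hp.2⟩, hBA p⟩
      rw [← travelTime_neg hG hl hv]
      exact hmono hp.1
    have hcont := continuousAt_of_monotoneOn_of_image_mem_nhds hBmono hnhds himg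
    have h := HasDerivAt.of_local_left_inverse hcont (hasDerivAt_travelTime hG hl hv hC (B y))
      (inv_pos.2 (hamiltonian_pos hG hC _)).ne' (eventually_of_mem hnhds hAB)
    rwa [inv_inv] at h
  have hl0 : (0 : ℝ) < l := by exact_mod_cast hl
  -- Since `B' = G + C` along the flow, the time change `y = -2l x` gives `p' = -2l (G(m) + C)` with
  -- `m` the point of momentum `p`. The inequality is then the tangent inequality at `m`.
  refine ⟨fun x => B (-(2 * l) * x),
    fun x => (G l v (momInv l v (B (-(2 * l) * x))) + C) * (-(2 * l)), fun x hx => ⟨?_, ?_⟩⟩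
  · have hy : -(2 * l) * x ∈ Ioo (-A P) (A P) := by
      obtain ⟨h1, h2⟩ := hx
      rw [div_le_iff₀ (by positivity)] at h1
      rw [le_div_iff₀ (by positivity)] at h2
      constructor <;> linarith
    have := (hderiv _ hy).comp x ((hasDerivAt_id x).const_mul (-(2 * (l : ℝ))))
    rw [mul_one] at this
    exact this
  · intro u
    set m := momInv l v (B (-(2 * l) * x)) with hm
    have h1 : B (-(2 * l) * x) = mom l v m := (mom_momInv hl hv _).symm
    have h2 := lagr_ge_tangent hG m u
    have h3 := G_eq (l := l) (v := v) m
    have h4 : (G l v m + C) * (-(2 * l)) / (2 * l) = -(G l v m + C) := by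
      field_simp
    simp only [← hm]
    rw [h4, h1]
    linarith

end

/-! ### The energy form and the Wirtinger inequality -/

/-- The homogeneous form of degree `2l` belonging to the Lagrangian. -/
noncomputable def energy (l : ℕ) (v : ℕ → ℝ) (z y : ℝ) : ℝ :=
  ∑ h ∈ Finset.Icc 1 l, coef l v h * (z ^ (2 * h) * y ^ (2 * l - 2 * h))

theorem energy_eq {y : ℝ} (hy : y ≠ 0) (z : ℝ) :
    energy l v z y = y ^ (2 * l) * lagr l v (z / y) := by
  unfold energy lagr
  rw [Finset.mul_sum]
  refine Finset.sum_congr rfl fun h hh => ?_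
  have h1 : y ^ (2 * l) = y ^ (2 * h) * y ^ (2 * l - 2 * h) := by
    rw [← pow_add]
    congr 1
    have := Finset.mem_Icc.1 hh
    omega
  rw [h1, div_pow]
  field_simp

theorem energy_zero (hl : 1 ≤ l) (hv : v l = 1) (z : ℝ) : energy l v z 0 = z ^ (2 * l) := by
  unfold energy
  rw [Finset.sum_eq_single_of_mem l (Finset.mem_Icc.2 ⟨hl, le_rfl⟩)]
  · simp [coef_self hl hv]
  · intro h hh hne
    have := Finset.mem_Icc.1 hh
    rw [zero_pow (by omega), mul_zero, mul_zero]

theorem energy_nonneg (hG : StrictMonoOn (G l v) (Ici 0)) (hl : 1 ≤ l) (hv : v l = 1) (z y : ℝ) :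
    0 ≤ energy l v z y := by
  rcases eq_or_ne y 0 with rfl | hy
  · rw [energy_zero hl hv, pow_mul]
    positivity
  · rw [energy_eq hy, pow_mul]
    have := lagr_nonneg hG (z / y)
    positivity

theorem energy_mono (hG : StrictMonoOn (G l v) (Ici 0)) (hl : 1 ≤ l) (hv : v l = 1) {a b z y : ℝ}
    (ha : 0 ≤ a) (hab : a ≤ b) (hz : 0 ≤ z) (hy : 0 ≤ y) :
    energy l v (a * z) y ≤ energy l v (b * z) y := by
  rcases hy.eq_or_lt with rfl | hy'
  · rw [energy_zero hl hv, energy_zero hl hv]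
    gcongr
  · rw [energy_eq hy'.ne', energy_eq hy'.ne']
    refine mul_le_mul_of_nonneg_left (monotoneOn_lagr hG ?_ ?_ ?_) (by positivity)
    · simp only [mem_Ici]; positivity
    · have := ha.trans hab
      simp only [mem_Ici]; positivity
    · gcongr

theorem energy_abs (k z y : ℝ) : energy l v (k * |z|) |y| = energy l v (k * z) y := by
  unfold energy
  refine Finset.sum_congr rfl fun h _ => ?_
  rw [← Nat.mul_sub, mul_pow, mul_pow, pow_mul |z|, pow_mul z, sq_abs, pow_mul |y|, pow_mul y,
    sq_abs]

/-- A Wirtinger type inequality on intervals of subcritical length. -/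
theorem wirtinger_energy (hG : StrictMonoOn (G l v) (Ici 0)) (hl : 1 ≤ l) (hv : v l = 1) {C : ℝ}
    (hC : 0 < C)
    (hint : ∫ u in Ioi (0 : ℝ), Real.log (1 + G l v u / C) / u ^ 2 = l * Real.pi)
    {f f' : ℝ → ℝ} (hf : ∀ t, HasDerivAt f (f' t) t) (hf' : Continuous f') {a b κ : ℝ}
    (hab : a ≤ b) (hfa : f a = 0) (hfb : f b = 0) (hκ : 0 < κ) (hlen : b - a < Real.pi * κ) :
    C * ∫ t in a..b, f t ^ (2 * l) ≤ ∫ t in a..b, energy l v (κ * f' t) (f t) := by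
  have hfc : Continuous f := continuous_iff_continuousAt.2 fun t => (hf t).continuousAt
  have hl0 : (0 : ℝ) < l := by exact_mod_cast hl
  -- In the variable `(t - c)/κ` the interval has length `(b - a)/κ = s/l`. The strict bound on `b -
  -- a` makes `s < lπ`, below the critical time.
  obtain ⟨p, p', hp⟩ := exists_calibration hG hl hv hC (s := l * ((b - a) / κ))
    (mul_nonneg hl0.le (div_nonneg (by linarith) hκ.le)) (by
      rw [hint]
      refine mul_lt_mul_of_pos_left ?_ hl0
      rwa [div_lt_iff₀ hκ])
  set c := (a + b) / 2 with hc
  have hx : ∀ t ∈ Icc a b, (t - c) / κ ∈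
      Icc (-(l * ((b - a) / κ)) / (2 * l)) (l * ((b - a) / κ) / (2 * l)) := by
    intro t ht
    have e1 : l * ((b - a) / κ) / (2 * l) = (b - a) / 2 / κ := by
      field_simp
    rw [neg_div, e1, ← neg_div]
    constructor
    · gcongr
      rw [hc]; linarith [ht.1]
    · gcongr
      rw [hc]; linarith [ht.2]
  set W : ℝ → ℝ := fun t => κ / (2 * l) * p ((t - c) / κ) * f t ^ (2 * l) with hW
  set W' : ℝ → ℝ := fun t => p' ((t - c) / κ) / (2 * l) * f t ^ (2 * l)
    + κ * p ((t - c) / κ) * f t ^ (2 * l - 1) * f' t with hW'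
  have hderiv : ∀ t ∈ Icc a b, HasDerivAt W (W' t) t := by
    intro t ht
    have h1 := (hp _ (hx t ht)).1.comp t (((hasDerivAt_id t).sub_const c).div_const κ)
    have h2 := (h1.const_mul (κ / (2 * l))).mul ((hf t).pow (2 * l))
    refine h2.congr_deriv ?_
    simp only [hW', Function.comp_apply, id, Pi.pow_apply]
    push_cast
    field_simp
  have hle : ∀ t ∈ Icc a b, W' t ≤ energy l v (κ * f' t) (f t) - C * f t ^ (2 * l) := by
    intro t ht
    -- At a zero of `f` the quotient `κ f'/f` is unavailable, but there `W' = 0` and the energy is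
    -- the nonnegative power `(κ f')^(2l)`.
    rcases eq_or_ne (f t) 0 with h0 | h0
    · simp only [hW', h0]
      rw [energy_zero hl hv, zero_pow (by omega : 2 * l ≠ 0), zero_pow (by omega : 2 * l - 1 ≠ 0),
        pow_mul]
      simp only [mul_zero, zero_mul, add_zero, sub_zero]
      positivity
    · have h1 := (hp _ (hx t ht)).2 (κ * f' t / f t)
      have h2 : f t ^ (2 * l) = f t * f t ^ (2 * l - 1) := by
        rw [← pow_succ']; congr 1; omega
      have h3 : W' t = f t ^ (2 * l)
          * (p' ((t - c) / κ) / (2 * l) + p ((t - c) / κ) * (κ * f' t / f t)) := by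
        simp only [hW']
        rw [h2]
        field_simp
      rw [h3, energy_eq h0]
      have h4 : 0 ≤ f t ^ (2 * l) := by rw [pow_mul]; positivity
      nlinarith [mul_le_mul_of_nonneg_left h1 h4]
  have hE : Continuous fun t => energy l v (κ * f' t) (f t) := by
    unfold energy
    fun_prop
  have hcont : Continuous fun t => energy l v (κ * f' t) (f t) - C * f t ^ (2 * l) := by
    fun_prop
  have key := intervalIntegral.sub_le_integral_of_hasDeriv_right_of_le hab (g := W) (g' := W')
    (fun t ht => (hderiv t ht).continuousAt.continuousWithinAt)
    (fun t ht => (hderiv t (Ioo_subset_Icc_self ht)).hasDerivWithinAt)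
    (hcont.continuousOn.integrableOn_Icc) (fun t ht => hle t (Ioo_subset_Icc_self ht))
  have hz : W b - W a = 0 := by
    simp only [hW, hfa, hfb]
    rw [zero_pow (by omega)]
    ring
  rw [hz, intervalIntegral.integral_sub (hE.intervalIntegrable _ _)
    ((by fun_prop : Continuous fun t => C * f t ^ (2 * l)).intervalIntegrable _ _),
    intervalIntegral.integral_const_mul] at key
  linarith

/-! ### The equation for `λ` -/

/-- The integrand in the equation for `lam`, as a function of `C = (2l-1) lam`. -/
noncomputable def logKernel (l : ℕ) (v : ℕ → ℝ) (C u : ℝ) : ℝ :=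
  Real.log (1 + G l v u / C) / u ^ 2

theorem exists_G_eq_sq_mul (l : ℕ) (v : ℕ → ℝ) :
    ∃ g : ℝ → ℝ, Continuous g ∧ ∀ u, G l v u = u ^ 2 * g u := by
  refine ⟨fun u => (2 * (l : ℝ) - 1) * ∑ h ∈ Finset.Icc 1 l,
    (l.choose h : ℝ) * v h * u ^ (2 * (h - 1)), by fun_prop, fun u => ?_⟩
  rw [mul_left_comm, Finset.mul_sum, G]
  congr 1
  refine Finset.sum_congr rfl fun h hh => ?_
  have h1 : u ^ (2 * h) = u ^ 2 * u ^ (2 * (h - 1)) := by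
    rw [← pow_add]
    congr 1
    have := Finset.mem_Icc.1 hh
    omega
  rw [h1]
  ring

theorem exists_G_le (l : ℕ) (v : ℕ → ℝ) :
    ∃ K : ℝ, 0 ≤ K ∧ ∀ u, 1 ≤ u → G l v u ≤ K * u ^ (2 * l) := by
  refine ⟨|2 * (l : ℝ) - 1| * ∑ h ∈ Finset.Icc 1 l, |(l.choose h : ℝ) * v h|,
    by positivity, fun u hu => ?_⟩
  refine (le_abs_self _).trans ?_
  rw [G, abs_mul, mul_assoc, Finset.sum_mul]
  gcongr
  refine (Finset.abs_sum_le_sum_abs _ _).trans (Finset.sum_le_sum fun h hh => ?_)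
  have h0 : 0 ≤ u := by linarith
  rw [abs_mul, abs_of_nonneg (pow_nonneg h0 _)]
  gcongr
  exact (Finset.mem_Icc.1 hh).2

section

variable (hG : StrictMonoOn (G l v) (Ici 0))
include hG

theorem one_le_one_add_G_div {C : ℝ} (hC : 0 < C) (u : ℝ) : 1 ≤ 1 + G l v u / C := by
  have := div_nonneg (G_nonneg hG u) hC.le
  linarith

theorem logKernel_nonneg {C : ℝ} (hC : 0 < C) (u : ℝ) : 0 ≤ logKernel l v C u :=
  div_nonneg (Real.log_nonneg (one_le_one_add_G_div hG hC u)) (sq_nonneg u)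

theorem logKernel_anti {C C' : ℝ} (hC : 0 < C) (hCC' : C ≤ C') (u : ℝ) :
    logKernel l v C' u ≤ logKernel l v C u := by
  have h1 := one_le_one_add_G_div hG (hC.trans_le hCC') u
  have h2 := G_nonneg hG u
  unfold logKernel
  gcongr

theorem logKernel_strictAnti {C C' u : ℝ} (hC : 0 < C) (hCC' : C < C') (hu : 0 < u) :
    logKernel l v C' u < logKernel l v C u := by
  have h1 := one_le_one_add_G_div hG (hC.trans hCC') u
  have h2 := G_pos hG hu
  unfold logKernel
  gcongr

theorem continuousOn_logKernel {C : ℝ} (hC : 0 < C) :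
    ContinuousOn (logKernel l v C) (Ioi 0) := by
  intro u hu
  have h1 := one_le_one_add_G_div hG hC u
  exact (((continuousAt_const.add (continuous_G.continuousAt.div_const C)).log
    (zero_lt_one.trans_le h1).ne').div (continuousAt_id.pow 2)
      (pow_ne_zero 2 (ne_of_gt hu))).continuousWithinAt

theorem aestronglyMeasurable_logKernel {C : ℝ} (hC : 0 < C) :
    AEStronglyMeasurable (logKernel l v C) (volume.restrict (Ioi 0)) :=
  (continuousOn_logKernel hG hC).aestronglyMeasurable measurableSet_Ioi

/-- Near `0` the kernel is bounded because `log(1 + x) ≤ x` and `G` is divisible by `u²`. At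
infinity the logarithm is `O(log u)`, hence `O(u^(1/2))`, which leaves `u^(-3/2)`. -/
theorem integrableOn_logKernel {C : ℝ} (hC : 0 < C) :
    IntegrableOn (logKernel l v C) (Ioi 0) := by
  have hmeas := aestronglyMeasurable_logKernel hG hC
  rw [← Ioc_union_Ioi_eq_Ioi zero_le_one]
  refine IntegrableOn.union ?_ ?_
  · obtain ⟨g, hg, hGg⟩ := exists_G_eq_sq_mul l v
    have hi : IntegrableOn (fun u => g u / C) (Ioc 0 1) :=
      (((hg.div_const C).continuousOn (s := Icc 0 1)).integrableOn_Icc).mono_set Ioc_subset_Icc_self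
    refine Integrable.mono' hi (hmeas.mono_set Ioc_subset_Ioi_self) ?_
    refine (ae_restrict_iff' measurableSet_Ioc).2 (Eventually.of_forall fun u hu => ?_)
    rw [Real.norm_of_nonneg (logKernel_nonneg hG hC u), logKernel,
      div_le_iff₀ (pow_pos hu.1 2)]
    have h1 := one_le_one_add_G_div hG hC u
    have h2 := Real.log_le_sub_one_of_pos (by linarith : 0 < 1 + G l v u / C)
    rw [hGg] at h2 ⊢
    refine h2.trans (le_of_eq ?_)
    ring
  · obtain ⟨K, hK, hGK⟩ := exists_G_le l v
    have hi : IntegrableOn (fun u : ℝ => (Real.log (1 + K / C) + 4 * l) * u ^ (-(3 / 2) : ℝ))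
        (Ioi 1) := by
      refine Integrable.const_mul ?_ _
      exact integrableOn_Ioi_rpow_of_lt (by norm_num) one_pos
    refine Integrable.mono' hi (hmeas.mono_set (Ioi_subset_Ioi zero_le_one)) ?_
    refine (ae_restrict_iff' measurableSet_Ioi).2 (Eventually.of_forall fun u hu => ?_)
    have hu1 : (1 : ℝ) ≤ u := le_of_lt hu
    have hu0 : (0 : ℝ) < u := by linarith
    rw [Real.norm_of_nonneg (logKernel_nonneg hG hC u), logKernel,
      div_le_iff₀ (pow_pos hu0 2)]
    have h1 := one_le_one_add_G_div hG hC u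
    have hKC : 0 ≤ K / C := by positivity
    have hpow : 1 ≤ u ^ (2 * l) := one_le_pow₀ hu1
    have h2 : 1 + G l v u / C ≤ (1 + K / C) * u ^ (2 * l) := by
      have : G l v u / C ≤ K / C * u ^ (2 * l) := by
        rw [div_mul_eq_mul_div]
        have := hGK u hu1
        gcongr
      linarith
    have h3 : Real.log (1 + G l v u / C) ≤ Real.log (1 + K / C) + 2 * l * Real.log u := by
      refine (Real.log_le_log (by linarith) h2).trans (le_of_eq ?_)
      rw [Real.log_mul (by positivity) (by positivity), Real.log_pow]
      push_cast
      ring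
    have h4 : Real.log u ≤ u ^ (1 / 2 : ℝ) / (1 / 2) := Real.log_le_rpow_div hu0.le (by norm_num)
    have h5 : (1 : ℝ) ≤ u ^ (1 / 2 : ℝ) := Real.one_le_rpow hu1 (by norm_num)
    have h6 : u ^ (-(3 / 2) : ℝ) * u ^ 2 = u ^ (1 / 2 : ℝ) := by
      rw [← Real.rpow_natCast, ← Real.rpow_add hu0]
      norm_num
    have h7 : 0 ≤ Real.log (1 + K / C) := Real.log_nonneg (by linarith)
    rw [mul_assoc, h6]
    have h8 : (0 : ℝ) ≤ l := l.cast_nonneg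
    nlinarith [mul_le_mul_of_nonneg_left h4 h8, mul_le_mul_of_nonneg_left h5 h7]

theorem tendsto_logKernel {C : ℝ} (hC : 0 < C) (u : ℝ) :
    Tendsto (fun C => logKernel l v C u) (𝓝 C) (𝓝 (logKernel l v C u)) := by
  have h1 := one_le_one_add_G_div hG hC u
  exact (((tendsto_const_nhds.div tendsto_id hC.ne').const_add 1).log
    (zero_lt_one.trans_le h1).ne').div_const _

theorem continuousAt_integral_logKernel {C : ℝ} (hC : 0 < C) :
    ContinuousAt (fun C => ∫ u in Ioi (0 : ℝ), logKernel l v C u) C := by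
  have hev : ∀ᶠ C' in 𝓝 C, C / 2 < C' := lt_mem_nhds (by linarith)
  refine tendsto_integral_filter_of_dominated_convergence (logKernel l v (C / 2)) ?_ ?_
    (integrableOn_logKernel hG (by linarith)) ?_
  · filter_upwards [hev] with C' hC'
    exact aestronglyMeasurable_logKernel hG (by linarith)
  · filter_upwards [hev] with C' hC'
    refine Eventually.of_forall fun u => ?_
    rw [Real.norm_of_nonneg (logKernel_nonneg hG (by linarith) u)]
    exact logKernel_anti hG (by linarith) hC'.le u
  · exact Eventually.of_forall fun u => tendsto_logKernel hG hC u

theorem tendsto_integral_logKernel :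
    Tendsto (fun C => ∫ u in Ioi (0 : ℝ), logKernel l v C u) atTop (𝓝 0) := by
  suffices h : Tendsto (fun C => ∫ u in Ioi (0 : ℝ), logKernel l v C u) atTop
      (𝓝 (∫ _ in Ioi (0 : ℝ), (0 : ℝ))) by
    rwa [integral_zero] at h
  refine tendsto_integral_filter_of_dominated_convergence (logKernel l v 1) ?_ ?_
    (integrableOn_logKernel hG one_pos) ?_
  · filter_upwards [eventually_gt_atTop 0] with C' hC'
    exact aestronglyMeasurable_logKernel hG hC'
  · filter_upwards [eventually_ge_atTop 1] with C' hC'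
    refine Eventually.of_forall fun u => ?_
    rw [Real.norm_of_nonneg (logKernel_nonneg hG (by linarith) u)]
    exact logKernel_anti hG one_pos hC' u
  · refine Eventually.of_forall fun u => ?_
    have h1 : Tendsto (fun C => 1 + G l v u / C) atTop (𝓝 (1 + 0)) :=
      (tendsto_const_nhds.div_atTop tendsto_id).const_add 1
    have h2 := (h1.log (by norm_num)).div_const (u ^ 2)
    simpa [logKernel] using h2

theorem strictAntiOn_integral_logKernel :
    StrictAntiOn (fun C => ∫ u in Ioi (0 : ℝ), logKernel l v C u) (Ioi 0) := by
  intro C hC C' hC' hCC'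
  have hi := (integrableOn_logKernel hG hC).sub (integrableOn_logKernel hG hC')
  have hpos : 0 < ∫ u in Ioi (0 : ℝ), (logKernel l v C - logKernel l v C') u := by
    rw [setIntegral_pos_iff_support_of_nonneg_ae _ hi]
    · have : Function.support (logKernel l v C - logKernel l v C') ∩ Ioi 0 = Ioi (0 : ℝ) := by
        refine inter_eq_right.2 fun u hu => ?_
        have := logKernel_strictAnti hG hC hCC' hu
        simp only [Function.mem_support, Pi.sub_apply]
        linarith
      rw [this, Real.volume_Ioi]
      exact ENNReal.zero_lt_top
    · refine Eventually.of_forall fun u => ?_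
      have := logKernel_anti hG hC hCC'.le u
      simp only [Pi.zero_apply, Pi.sub_apply]
      linarith
  rw [integral_sub' (integrableOn_logKernel hG hC) (integrableOn_logKernel hG hC')] at hpos
  simp only
  linarith

/-- Restricting to `(1, 2]`, where `G(u) ≥ G(1)` and `u² ≤ 4`, shows that the integral is unbounded
as `C → 0`. -/
theorem le_integral_logKernel {C : ℝ} (hC : 0 < C) :
    Real.log (1 + G l v 1 / C) / 4 ≤ ∫ u in Ioi (0 : ℝ), logKernel l v C u := by
  have hi := integrableOn_logKernel hG hC
  have hsub : Ioc (1 : ℝ) 2 ⊆ Ioi 0 := fun u hu => lt_trans one_pos hu.1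
  have h1 : ∫ u in Ioc (1 : ℝ) 2, logKernel l v C u ≤ ∫ u in Ioi (0 : ℝ), logKernel l v C u :=
    setIntegral_mono_set hi (Eventually.of_forall fun u => logKernel_nonneg hG hC u)
      hsub.eventuallyLE
  have h2 : ∫ _ in Ioc (1 : ℝ) 2, Real.log (1 + G l v 1 / C) / 4
      ≤ ∫ u in Ioc (1 : ℝ) 2, logKernel l v C u := by
    refine setIntegral_mono_on (by simp) (hi.mono_set hsub) measurableSet_Ioc fun u hu => ?_
    have h3 := one_le_one_add_G_div hG hC 1
    have h4 : G l v 1 ≤ G l v u :=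
      hG.monotoneOn (by simp) (mem_Ici.2 (by linarith [hu.1])) hu.1.le
    have h5 : u ^ 2 ≤ 4 := by nlinarith [hu.1, hu.2]
    have h6 : 0 < u := by linarith [hu.1]
    unfold logKernel
    have h7 : 0 ≤ Real.log (1 + G l v u / C) :=
      Real.log_nonneg (one_le_one_add_G_div hG hC u)
    gcongr
  refine le_trans (le_of_eq ?_) (h2.trans h1)
  simp
  norm_num

theorem exists_integral_logKernel_eq {s : ℝ} (hs : 0 < s) :
    ∃ C, 0 < C ∧ ∫ u in Ioi (0 : ℝ), logKernel l v C u = s := by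
  have hG1 := G_pos hG one_pos
  -- Chosen so that the lower bound becomes `log(1 + e^(4s)) / 4 ≥ s`.
  set C₁ := G l v 1 / Real.exp (4 * s) with hC₁
  have hC₁pos : 0 < C₁ := by positivity
  have h1 : s ≤ ∫ u in Ioi (0 : ℝ), logKernel l v C₁ u := by
    refine le_trans ?_ (le_integral_logKernel hG hC₁pos)
    have : G l v 1 / C₁ = Real.exp (4 * s) := by
      rw [hC₁]
      field_simp
    rw [this, le_div_iff₀ (by norm_num), Real.le_log_iff_exp_le (by positivity), mul_comm]
    linarith
  obtain ⟨C₂, h2, hC⟩ := (((tendsto_order.1 (tendsto_integral_logKernel hG)).2 s hs).and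
    (eventually_ge_atTop C₁)).exists
  obtain ⟨C, hC', hC''⟩ := intermediate_value_Icc' hC
    (fun C hC => (continuousAt_integral_logKernel hG
      (hC₁pos.trans_le hC.1)).continuousWithinAt) ⟨h2.le, h1⟩
  exact ⟨C, hC₁pos.trans_le hC'.1, hC''⟩

end

theorem existsUnique_isLambda (hG : StrictMonoOn (G l v) (Ici 0)) (hl : 1 ≤ l) :
    ∃! lam : ℝ, IsLambda l v lam := by
  have hl2 := two_mul_sub_one_pos hl
  have hl0 : (0 : ℝ) < l := by exact_mod_cast hl
  obtain ⟨C, hC, hCs⟩ := exists_integral_logKernel_eq hG (mul_pos hl0 Real.pi_pos)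
  have hC2 : (2 * (l : ℝ) - 1) * (C / (2 * l - 1)) = C := by field_simp
  refine ⟨C / (2 * l - 1), ⟨by positivity, ?_⟩, fun lam hlam => ?_⟩
  · rw [hC2]
    exact hCs
  · have h1 := (strictAntiOn_integral_logKernel hG).injOn (x₁ := (2 * l - 1) * lam) (x₂ := C)
      (mul_pos hl2 hlam.1) hC (hlam.2.trans hCs.symm)
    rw [← h1]
    field_simp

/-! ### Analyticity of Hardy's function -/

open scoped ContDiff in
theorem analyticAt_hardyZ (t : ℝ) : AnalyticAt ℝ hardyZ t := by
  -- The norm of `Γ` is only real-analytic, so the factors are combined as `C^ω` functions over `ℝ`;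
  -- `Γ ≠ 0` on the right half-plane.
  have hs : ContDiffAt ℝ ω (fun t : ℝ => Complex.I * (t : ℂ)) t :=
    contDiffAt_const.mul Complex.ofRealCLM.contDiff.contDiffAt
  have hs2 : ContDiffAt ℝ ω (fun t : ℝ => Complex.I * (t : ℂ) / 2) t := hs.div_const 2
  have hcomp : ∀ {F : ℂ → ℂ} {g : ℝ → ℂ}, AnalyticAt ℂ F (g t) → ContDiffAt ℝ ω g t →
      ContDiffAt ℝ ω (fun t => F (g t)) t := fun hF hg =>
    (hF.contDiffAt.restrict_scalars ℝ).comp t hg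
  have hre4 : 0 < (1 / 4 + Complex.I * t / 2 : ℂ).re := by norm_num
  have hGan : AnalyticAt ℂ Complex.Gamma (1 / 4 + Complex.I * t / 2) := by
    refine DifferentiableOn.analyticAt (s := {z : ℂ | 0 < z.re}) (fun z hz => ?_)
      ((isOpen_lt continuous_const Complex.continuous_re).mem_nhds hre4)
    refine (Complex.differentiableAt_Gamma z fun m hm => ?_).differentiableWithinAt
    rw [hm] at hz
    have : (0 : ℝ) ≤ m := m.cast_nonneg
    simp at hz
    linarith
  have hZan : AnalyticAt ℂ riemannZeta (1 / 2 + Complex.I * t) := by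
    refine DifferentiableOn.analyticAt (s := {1}ᶜ)
      (fun z hz => (differentiableAt_riemannZeta hz).differentiableWithinAt)
      (isOpen_compl_singleton.mem_nhds fun h => ?_)
    have := congrArg Complex.re h
    norm_num at this
  have hG := hcomp (g := fun t : ℝ => 1 / 4 + Complex.I * t / 2) hGan (contDiffAt_const.add hs2)
  have hZ := hcomp (g := fun t : ℝ => 1 / 2 + Complex.I * t) hZan (contDiffAt_const.add hs)
  have hPan : AnalyticAt ℂ (fun z : ℂ => (Real.pi : ℂ) ^ z) (-(Complex.I * t / 2)) :=
    analyticAt_const.cpow analyticAt_id (Complex.ofReal_mem_slitPlane.2 Real.pi_pos)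
  have hP := hcomp (g := fun t : ℝ => -(Complex.I * t / 2)) hPan hs2.neg
  have hG0 : Complex.Gamma (1 / 4 + Complex.I * t / 2) ≠ 0 := Complex.Gamma_ne_zero_of_re_pos hre4
  have hN : ContDiffAt ℝ ω (fun t : ℝ => ((‖Complex.Gamma (1 / 4 + Complex.I * t / 2)‖ : ℝ) : ℂ)) t :=
    Complex.ofRealCLM.contDiff.contDiffAt.comp t (hG.norm ℝ hG0)
  have hN0 : ((‖Complex.Gamma (1 / 4 + Complex.I * t / 2)‖ : ℝ) : ℂ) ≠ 0 := by
    rw [Complex.ofReal_ne_zero]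
    exact norm_ne_zero_iff.2 hG0
  have hE : ContDiffAt ℝ ω hardyZExpr t := (hP.mul (hG.mul (hN.inv hN0))).mul hZ
  exact (Complex.reCLM.contDiff.contDiffAt.comp t hE).analyticAt

theorem analyticAt_hardyZDeriv (n : ℕ) (t : ℝ) : AnalyticAt ℝ (hardyZDeriv n) t := by
  unfold hardyZDeriv
  rw [iteratedDeriv_eq_iterate]
  exact (analyticAt_hardyZ t).iterated_deriv n

theorem continuous_hardyZDeriv (n : ℕ) : Continuous (hardyZDeriv n) :=
  continuous_iff_continuousAt.2 fun t => (analyticAt_hardyZDeriv n t).continuousAt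

theorem hasDerivAt_hardyZDeriv (n : ℕ) (t : ℝ) :
    HasDerivAt (hardyZDeriv n) (hardyZDeriv (n + 1) t) t := by
  have h := (analyticAt_hardyZDeriv n t).differentiableAt.hasDerivAt
  have h1 : hardyZDeriv (n + 1) = deriv (hardyZDeriv n) := iteratedDeriv_succ
  rwa [h1]

/-! ### The sequence of zeros of a real-analytic function -/

section

variable {f : ℝ → ℝ}

theorem zeroCount_mono (f : ℝ → ℝ) : Monotone (zeroCount f) := fun _ _ hxy =>
  encard_le_encard fun _ hp => ⟨hp.1, hp.2.1.trans hxy, hp.2.2⟩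

theorem zero_of_lt_analyticOrderAt {z : ℝ} {r : ℕ} (h : (r : ℕ∞) < analyticOrderAt f z) :
    f z = 0 :=
  apply_eq_zero_of_analyticOrderAt_ne_zero (ne_of_gt (lt_of_le_of_lt zero_le h))

variable (hf : ∀ t, AnalyticAt ℝ f t)
include hf

theorem exists_lt_zeroCount (hinf : {t : ℝ | 0 ≤ t ∧ f t = 0}.Infinite) (k : ℕ) :
    ∃ x, (k : ℕ∞) < zeroCount f x := by
  obtain ⟨s, hs, hcard⟩ := hinf.exists_subset_card_eq (k + 1)
  obtain ⟨x, hx⟩ := s.bddAbove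
  refine ⟨x, ?_⟩
  have h1 : (fun z : ℝ => (z, 0)) '' (s : Set ℝ) ⊆
      {p : ℝ × ℕ | 0 ≤ p.1 ∧ p.1 ≤ x ∧ (p.2 : ℕ∞) < analyticOrderAt f p.1} := by
    rintro _ ⟨z, hz, rfl⟩
    refine ⟨(hs hz).1, hx hz, ?_⟩
    simp only [Nat.cast_zero]
    rw [pos_iff_ne_zero, (hf z).analyticOrderAt_ne_zero]
    exact (hs hz).2
  have h2 := encard_le_encard h1
  rw [Function.Injective.encard_image (fun a b h => congrArg Prod.fst h),
    encard_coe_eq_coe_finsetCard,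
    hcard] at h2
  refine lt_of_lt_of_le ?_ h2
  exact_mod_cast Nat.lt_succ_self k

variable (hf0 : ∃ t, f t ≠ 0)
include hf0

theorem eventually_ne_zero_of_analytic (t : ℝ) : ∀ᶠ s in 𝓝[≠] t, f s ≠ 0 := by
  by_contra h
  obtain ⟨u, hu⟩ := hf0
  have h' : ∃ᶠ s in 𝓝[≠] t, f s = 0 := fun h0 => h h0
  exact hu (AnalyticOnNhd.eqOn_zero_of_preconnected_of_frequently_eq_zero (fun x _ => hf x)
    isPreconnected_univ (mem_univ t) h' (mem_univ u))

theorem analyticOrderAt_ne_top_of_exists_ne (t : ℝ) : analyticOrderAt f t ≠ ⊤ := by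
  rw [Ne, analyticOrderAt_eq_top]
  intro h
  obtain ⟨s, hs1, hs2⟩ := ((eventually_ne_zero_of_analytic hf hf0 t).and
    (h.filter_mono nhdsWithin_le_nhds)).exists
  exact hs1 hs2

theorem finite_zeros_Icc (x : ℝ) : {z | z ∈ Icc 0 x ∧ f z = 0}.Finite := by
  by_contra h
  obtain ⟨t, -, ht⟩ := Set.Infinite.exists_accPt_of_subset_isCompact h isCompact_Icc
    (fun z hz => hz.1)
  rw [accPt_iff_frequently_nhdsNE] at ht
  obtain ⟨s, hs1, hs2⟩ := (ht.and_eventually (eventually_ne_zero_of_analytic hf hf0 t)).exists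
  exact hs2 hs1.2

theorem zeroCount_ne_top (x : ℝ) : zeroCount f x ≠ ⊤ := by
  have hfin : {p : ℝ × ℕ | 0 ≤ p.1 ∧ p.1 ≤ x ∧ (p.2 : ℕ∞) < analyticOrderAt f p.1}.Finite := by
    refine ((finite_zeros_Icc hf hf0 x).biUnion (t := fun z =>
      (Prod.mk z) '' Iio (analyticOrderAt f z).toNat) fun z _ =>
        (finite_Iio _).image _).subset fun p hp => ?_
    simp only [mem_iUnion]
    refine ⟨p.1, ⟨⟨hp.1, hp.2.1⟩, zero_of_lt_analyticOrderAt hp.2.2⟩, p.2, ?_, rfl⟩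
    have h1 := hp.2.2
    rw [← ENat.natCast_toNat (analyticOrderAt_ne_top_of_exists_ne hf hf0 p.1)] at h1
    exact_mod_cast h1
  exact hfin.encard_lt_top.ne

variable (hinf : {t : ℝ | 0 ≤ t ∧ f t = 0}.Infinite)
include hinf

/-- The infimum defining `zeroSeq` is attained, at a zero. -/
theorem zeroSeq_spec (k : ℕ) :
    f (zeroSeq f k) = 0 ∧ IsLeast {x : ℝ | (k : ℕ∞) < zeroCount f x} (zeroSeq f k) := by
  set S := {x : ℝ | (k : ℕ∞) < zeroCount f x} with hS
  -- Counts change only at zeros: the largest zero `z ≤ x` has the same count as `x`. So the infimum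
  -- reduces to a minimum over finitely many zeros.
  have hz : ∀ x ∈ S, ∃ z ∈ Icc 0 x, f z = 0 ∧ z ∈ S := by
    intro x hx
    have hne : {z | z ∈ Icc 0 x ∧ f z = 0}.Nonempty := by
      have h0 : 0 < zeroCount f x := lt_of_le_of_lt zero_le hx
      obtain ⟨p, hp⟩ := encard_pos.1 h0
      exact ⟨p.1, ⟨hp.1, hp.2.1⟩, zero_of_lt_analyticOrderAt hp.2.2⟩
    obtain ⟨z, hz, hmax⟩ := (finite_zeros_Icc hf hf0 x).exists_maximal hne |>.imp
      fun z h => (⟨h.1, fun w hw => le_of_not_gt fun hlt => (h.not_gt hw hlt)⟩ :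
        z ∈ {z | z ∈ Icc 0 x ∧ f z = 0} ∧ ∀ w ∈ {z | z ∈ Icc 0 x ∧ f z = 0}, w ≤ z)
    refine ⟨z, hz.1, hz.2, lt_of_lt_of_le hx (encard_le_encard fun p hp => ?_)⟩
    exact ⟨hp.1, hmax p.1 ⟨⟨hp.1, hp.2.1⟩, zero_of_lt_analyticOrderAt hp.2.2⟩, hp.2.2⟩
  obtain ⟨x, hx⟩ := exists_lt_zeroCount hf hinf k
  obtain ⟨z₁, hz₁, hz₁0, hz₁S⟩ := hz x hx
  obtain ⟨z, hz', hmin⟩ := ((finite_zeros_Icc hf hf0 x).subset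
    (fun z (h : z ∈ {z | z ∈ Icc 0 x ∧ f z = 0} ∩ S) => h.1)).exists_minimal
      ⟨z₁, ⟨hz₁, hz₁0⟩, hz₁S⟩ |>.imp
      fun z h => (⟨h.1, fun w hw => le_of_not_gt fun hlt => (h.not_lt hw hlt)⟩ :
        z ∈ {z | z ∈ Icc 0 x ∧ f z = 0} ∩ S ∧ ∀ w ∈ {z | z ∈ Icc 0 x ∧ f z = 0} ∩ S, z ≤ w)
  have hleast : IsLeast S z := by
    refine ⟨hz'.2, fun y hy => ?_⟩
    obtain ⟨w, hw, hw0, hwS⟩ := hz y hy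
    rcases le_total y x with hyx | hxy
    · exact (hmin w ⟨⟨⟨hw.1, hw.2.trans hyx⟩, hw0⟩, hwS⟩).trans hw.2
    · exact hz'.1.1.2.trans hxy
  have heq : zeroSeq f k = z := hleast.csInf_eq
  rw [heq]
  exact ⟨hz'.1.2, hleast⟩

theorem zeroSeq_mono : Monotone (zeroSeq f) := by
  intro j k hjk
  have h : (j : ℕ∞) ≤ k := by exact_mod_cast hjk
  exact (zeroSeq_spec hf hf0 hinf j).2.2 (lt_of_le_of_lt h (zeroSeq_spec hf hf0 hinf k).2.1)

theorem tendsto_zeroSeq : Tendsto (zeroSeq f) atTop atTop := by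
  refine tendsto_atTop_atTop.2 fun M => ?_
  obtain ⟨m, hm⟩ := ENat.ne_top_iff_exists.1 (zeroCount_ne_top hf hf0 M)
  refine ⟨m, fun k hk => ?_⟩
  by_contra! h
  have h1 := lt_of_lt_of_le (zeroSeq_spec hf hf0 hinf k).2.1 (zeroCount_mono f h.le)
  rw [← hm] at h1
  have h2 : k < m := by exact_mod_cast h1
  omega

end

/-! ### Moments and their limits -/

variable {n : ℕ} {d : ℕ → ℝ}

theorem IsLeadingCoeff.tendsto {h : ℕ} {c : ℝ} (hc : IsLeadingCoeff l h n c) :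
    Tendsto (fun T => jointMoment l h n T / Real.log T ^ (l ^ 2 + 2 * l * n + 2 * h)) atTop
      (𝓝 c) := by
  have h1 := (hc.isLittleO.trans_isBigO (Asymptotics.isBigO_const_mul_self c
    (fun T : ℝ => Real.log T ^ (l ^ 2 + 2 * l * n + 2 * h)) atTop)).tendsto_div_nhds_zero
  have h2 := h1.add_const c
  rw [zero_add] at h2
  refine h2.congr' ?_
  filter_upwards [eventually_gt_atTop 1] with T hT
  have := (pow_pos (Real.log_pos hT) (l ^ 2 + 2 * l * n + 2 * h)).ne'
  simp only [Pi.sub_apply]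
  field_simp
  ring

theorem jointMoment_nonneg (h : ℕ) {T : ℝ} (hT : 0 ≤ T) : 0 ≤ jointMoment l h n T := by
  unfold jointMoment
  refine mul_nonneg (by positivity) (intervalIntegral.integral_nonneg hT fun t _ => ?_)
  positivity

theorem IsLeadingCoeff.nonneg {h : ℕ} {c : ℝ} (hc : IsLeadingCoeff l h n c) : 0 ≤ c := by
  refine ge_of_tendsto hc.tendsto ?_
  filter_upwards [eventually_gt_atTop 1] with T hT
  exact div_nonneg (jointMoment_nonneg h (by linarith)) (pow_pos (Real.log_pos hT) _).le

theorem jointMoment_zero (l n : ℕ) (T : ℝ) :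
    jointMoment l 0 n T = 1 / T * ∫ t in (0 : ℝ)..T, hardyZDeriv n t ^ (2 * l) := by
  unfold jointMoment
  congr 1
  refine intervalIntegral.integral_congr fun t _ => ?_
  simp [pow_mul, sq_abs]

theorem exists_hardyZDeriv_ne_zero (hl : 1 ≤ l) {c : ℝ} (hc : IsLeadingCoeff l l n c)
    (hc0 : c ≠ 0) : ∃ t, hardyZDeriv n t ≠ 0 := by
  by_contra! h
  have h1 : ∀ t, hardyZDeriv (n + 1) t = 0 := fun t => by
    have h2 := hasDerivAt_hardyZDeriv n t
    rw [show hardyZDeriv n = fun _ => 0 from funext h] at h2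
    exact h2.unique (hasDerivAt_const t 0)
  refine hc0 (tendsto_nhds_unique hc.tendsto (tendsto_const_nhds.congr fun T => ?_))
  have h2 : 2 * l ≠ 0 := by omega
  simp [jointMoment, h1, h2]

/-- Asymptotic equivalence to `0` means being eventually equal to `0`, while the integral of the
even power of a nonzero analytic function is positive. -/
theorem IsLeadingCoeff.zero_pos (hf0 : ∃ t, hardyZDeriv n t ≠ 0) {c : ℝ}
    (hc : IsLeadingCoeff l 0 n c) : 0 < c := by
  refine lt_of_le_of_ne hc.nonneg fun h0 => ?_
  subst h0
  have h1 : jointMoment l 0 n =ᶠ[atTop] 0 := by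
    have h2 := hc
    unfold IsLeadingCoeff at h2
    simp only [zero_mul] at h2
    exact Asymptotics.isEquivalent_zero_iff_eventually_zero.1 h2
  obtain ⟨T, hT, hT1⟩ := (h1.and (eventually_ge_atTop 1)).exists
  obtain ⟨s, hs, hs0⟩ := ((Icc_infinite (zero_lt_one' ℝ)).sdiff
    (finite_zeros_Icc (analyticAt_hardyZDeriv n) hf0 1)).nonempty
  have hs1 : hardyZDeriv n s ≠ 0 := fun h => hs0 ⟨hs, h⟩
  have hpos : 0 < ∫ t in (0 : ℝ)..T, hardyZDeriv n t ^ (2 * l) := by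
    refine intervalIntegral.integral_pos (by linarith)
      ((continuous_hardyZDeriv n).pow _).continuousOn (fun t _ => ?_)
      ⟨s, ⟨hs.1, hs.2.trans hT1⟩, ?_⟩
    · rw [pow_mul]; positivity
    · rw [pow_mul]; positivity
  rw [jointMoment_zero] at hT
  have : 0 < 1 / T := by positivity
  exact (mul_pos this hpos).ne' hT

/-- The polynomial that arises as the limit of the moments of the energy. -/
noncomputable def energyLimit (l : ℕ) (d v : ℕ → ℝ) (s : ℝ) : ℝ :=
  ∑ h ∈ Finset.Icc 1 l, coef l v h * (s ^ (2 * h) * d h)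

theorem continuous_energy {g f : ℝ → ℝ} (hg : Continuous g) (hf : Continuous f) :
    Continuous fun t => energy l v (g t) (f t) := by
  unfold energy
  fun_prop

theorem integral_energy (κ T : ℝ) :
    1 / T * ∫ t in (0 : ℝ)..T, energy l v (κ * hardyZDeriv (n + 1) t) (hardyZDeriv n t)
      = ∑ h ∈ Finset.Icc 1 l, coef l v h * (κ ^ (2 * h) * jointMoment l h n T) := by
  have hc := continuous_hardyZDeriv n
  have hc' := continuous_hardyZDeriv (n + 1)
  have h1 : ∀ t, energy l v (κ * hardyZDeriv (n + 1) t) (hardyZDeriv n t)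
      = ∑ h ∈ Finset.Icc 1 l, coef l v h * κ ^ (2 * h) *
        (|hardyZDeriv (n + 1) t| ^ (2 * h) * |hardyZDeriv n t| ^ (2 * l - 2 * h)) := fun t => by
    rw [← energy_abs, energy]
    refine Finset.sum_congr rfl fun h _ => ?_
    rw [mul_pow]
    ring
  simp only [h1]
  rw [intervalIntegral.integral_finsetSum, Finset.mul_sum]
  · refine Finset.sum_congr rfl fun h _ => ?_
    rw [intervalIntegral.integral_const_mul, jointMoment]
    ring
  · intro h _
    exact Continuous.intervalIntegrable (by fun_prop) _ _

theorem tendsto_energy_moment (hd : ∀ h ≤ l, IsLeadingCoeff l h n (d h)) {κ : ℝ → ℝ} {s : ℝ}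
    (hκ : Tendsto (fun T => κ T * Real.log T) atTop (𝓝 s)) :
    Tendsto (fun T => (1 / T * ∫ t in (0 : ℝ)..T,
      energy l v (κ T * hardyZDeriv (n + 1) t) (hardyZDeriv n t)) /
        Real.log T ^ (l ^ 2 + 2 * l * n)) atTop (𝓝 (energyLimit l d v s)) := by
  have h1 : Tendsto (fun T => ∑ h ∈ Finset.Icc 1 l, coef l v h * ((κ T * Real.log T) ^ (2 * h) *
      (jointMoment l h n T / Real.log T ^ (l ^ 2 + 2 * l * n + 2 * h)))) atTop
      (𝓝 (energyLimit l d v s)) := by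
    refine tendsto_finsetSum _ fun h hh => ?_
    exact ((hκ.pow _).mul (hd h (Finset.mem_Icc.1 hh).2).tendsto).const_mul _
  refine h1.congr' ?_
  filter_upwards [eventually_gt_atTop 1] with T hT
  have hT' := (Real.log_pos hT).ne'
  rw [integral_energy, Finset.sum_div]
  refine Finset.sum_congr rfl fun h _ => ?_
  rw [mul_pow, pow_add]
  field_simp

/-- The `v_h` may be negative, so this cannot be read off the coefficients. It is inherited from the
pointwise monotonicity of the energy in its first argument, with `κ = s / log T` and `T → ∞`. -/
theorem energyLimit_mono (hG : StrictMonoOn (G l v) (Ici 0)) (hl : 1 ≤ l) (hv : v l = 1)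
    (hd : ∀ h ≤ l, IsLeadingCoeff l h n (d h)) {a b : ℝ} (ha : 0 ≤ a) (hab : a ≤ b) :
    energyLimit l d v a ≤ energyLimit l d v b := by
  have hlim : ∀ s : ℝ, Tendsto (fun T => s / Real.log T * Real.log T) atTop (𝓝 s) := fun s => by
    refine tendsto_const_nhds.congr' ?_
    filter_upwards [eventually_gt_atTop 1] with T hT
    have := (Real.log_pos hT).ne'
    field_simp
  refine le_of_tendsto_of_tendsto (tendsto_energy_moment hd (hlim a))
    (tendsto_energy_moment hd (hlim b)) ?_
  filter_upwards [eventually_gt_atTop 1] with T hT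
  have hlog := Real.log_pos hT
  have hT0 : 0 < T := by linarith
  have hcont : ∀ s : ℝ, Continuous fun t =>
      energy l v (s * hardyZDeriv (n + 1) t) (hardyZDeriv n t) := fun s =>
    continuous_energy ((continuous_hardyZDeriv _).const_mul s) (continuous_hardyZDeriv n)
  gcongr
  refine intervalIntegral.integral_mono_on hT0.le ((hcont _).intervalIntegrable _ _)
    ((hcont _).intervalIntegrable _ _) fun t _ => ?_
  rw [← energy_abs, ← energy_abs (b / Real.log T)]
  exact energy_mono hG hl hv (by positivity) (by gcongr) (abs_nonneg _) (abs_nonneg _)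

theorem tendsto_log_div_log_log (c : ℝ) (hc : 0 < c) :
    Tendsto (fun T => Real.log (c * (T / Real.log T)) / Real.log T) atTop (𝓝 1) := by
  have h1 : Tendsto (fun T => Real.log (Real.log T) / Real.log T) atTop (𝓝 0) :=
    (Real.isLittleO_log_id_atTop.tendsto_div_nhds_zero).comp Real.tendsto_log_atTop
  have h2 : Tendsto (fun T => Real.log c / Real.log T) atTop (𝓝 0) :=
    tendsto_const_nhds.div_atTop Real.tendsto_log_atTop
  have h3 := (h2.add_const 1).sub h1
  rw [zero_add, sub_zero] at h3
  refine h3.congr' ?_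
  filter_upwards [eventually_gt_atTop 1] with T hT
  have hlog := Real.log_pos hT
  rw [Real.log_mul hc.ne' (by positivity), Real.log_div (by positivity) hlog.ne']
  field_simp
  ring

theorem tendsto_div_log_atTop : Tendsto (fun T => T / Real.log T) atTop atTop := by
  have h1 : Tendsto (fun T => Real.log T / T) atTop (𝓝[>] 0) := by
    refine tendsto_nhdsWithin_iff.2 ⟨Real.isLittleO_log_id_atTop.tendsto_div_nhds_zero, ?_⟩
    filter_upwards [eventually_gt_atTop 1] with T hT
    have := Real.log_pos hT
    simp only [mem_Ioi]
    positivity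
  refine h1.inv_tendsto_nhdsGT_zero.congr fun T => ?_
  simp

/-- The part of the moment over a short initial interval is negligible. -/
theorem tendsto_initial_moment {c : ℝ} (hc : IsLeadingCoeff l 0 n c) :
    Tendsto (fun T => (1 / T * ∫ t in (0 : ℝ)..2 * (T / Real.log T), hardyZDeriv n t ^ (2 * l)) /
      Real.log T ^ (l ^ 2 + 2 * l * n)) atTop (𝓝 0) := by
  have hT0 : Tendsto (fun T => 2 * (T / Real.log T)) atTop atTop :=
    tendsto_div_log_atTop.const_mul_atTop two_pos
  have h1 := hc.tendsto.comp hT0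
  have h2 := (tendsto_log_div_log_log 2 two_pos).pow (l ^ 2 + 2 * l * n)
  have h3 : Tendsto (fun T => 2 / Real.log T) atTop (𝓝 0) :=
    tendsto_const_nhds.div_atTop Real.tendsto_log_atTop
  -- Shortening the range to `2T / log T` gains a factor `2 / log T`, while the powers of the two
  -- logarithms are asymptotically equal.
  have h4 := h3.mul (h1.mul h2)
  rw [zero_mul] at h4
  refine h4.congr' ?_
  filter_upwards [eventually_gt_atTop 1, hT0.eventually_gt_atTop 1] with T hT hT1
  have hlog := Real.log_pos hT
  have hlog1 := Real.log_pos hT1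
  simp only [Function.comp_apply, jointMoment_zero, mul_zero, add_zero]
  rw [div_pow]
  have h5 := (pow_pos hlog1 (l ^ 2 + 2 * l * n)).ne'
  generalize Real.log (2 * (T / Real.log T)) ^ (l ^ 2 + 2 * l * n) = L at *
  generalize (∫ t in (0 : ℝ)..2 * (T / Real.log T), hardyZDeriv n t ^ (2 * l)) = I
  have hT0' : T ≠ 0 := by positivity
  field_simp

/-! ### From gaps to moments -/

/-- Summation of the Wirtinger inequality over consecutive zeros. -/
theorem energy_sum_zeros (hG : StrictMonoOn (G l v) (Ici 0)) (hl : 1 ≤ l) (hv : v l = 1) {C : ℝ}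
    (hC : 0 < C)
    (hint : ∫ u in Ioi (0 : ℝ), Real.log (1 + G l v u / C) / u ^ 2 = l * Real.pi)
    {f f' : ℝ → ℝ} (hf : ∀ t, HasDerivAt f (f' t) t) (hf' : Continuous f') {t : ℕ → ℝ}
    (ht : Monotone t) (hft : ∀ k, f (t k) = 0) {κ : ℝ} (hκ : 0 < κ) {a b : ℕ} (hab : a ≤ b)
    (hgap : ∀ k, a ≤ k → t (k + 1) - t k < Real.pi * κ) :
    C * ∫ s in t a..t b, f s ^ (2 * l) ≤ ∫ s in t a..t b, energy l v (κ * f' s) (f s) := by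
  have hfc : Continuous f := continuous_iff_continuousAt.2 fun t => (hf t).continuousAt
  have hE : Continuous fun s => energy l v (κ * f' s) (f s) :=
    continuous_energy (hf'.const_mul κ) hfc
  have hP : Continuous fun s => f s ^ (2 * l) := hfc.pow _
  induction b, hab using Nat.le_induction with
  | base => simp
  | succ k hk ih =>
    have h1 := wirtinger_energy hG hl hv hC hint hf hf' (ht (Nat.le_succ k)) (hft k) (hft (k + 1))
      hκ (hgap k hk)
    rw [← intervalIntegral.integral_add_adjacent_intervals (hP.intervalIntegrable (t a) (t k))
      (hP.intervalIntegrable (t k) (t (k + 1))),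
      ← intervalIntegral.integral_add_adjacent_intervals (hE.intervalIntegrable (t a) (t k))
      (hE.intervalIntegrable (t k) (t (k + 1))), mul_add]
    exact add_le_add ih h1

/-- If all large normalised gaps are smaller than `K`, then the moments satisfy the limiting
Wirtinger inequality with parameter `2K`. -/
theorem le_energyLimit_of_gaps (hG : StrictMonoOn (G l v) (Ici 0)) (hl : 1 ≤ l) (hv : v l = 1)
    {C : ℝ} (hC : 0 < C)
    (hint : ∫ u in Ioi (0 : ℝ), Real.log (1 + G l v u / C) / u ^ 2 = l * Real.pi)
    (hd : ∀ h ≤ l, IsLeadingCoeff l h n (d h)) (hf0 : ∃ t, hardyZDeriv n t ≠ 0)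
    (hinf : {t : ℝ | 0 ≤ t ∧ hardyZDeriv n t = 0}.Infinite) {K : ℝ} (hK : 0 < K)
    (hgap : ∀ᶠ k in atTop, (zeroSeq (hardyZDeriv n) (k + 1) - zeroSeq (hardyZDeriv n) k)
        / (2 * Real.pi / Real.log (zeroSeq (hardyZDeriv n) k)) < K) :
    C * d 0 ≤ energyLimit l d v (2 * K) := by
  set f := hardyZDeriv n with hfdef
  set f' := hardyZDeriv (n + 1) with hf'def
  have hfa : ∀ t, AnalyticAt ℝ f t := analyticAt_hardyZDeriv n
  have hfc : Continuous f := continuous_hardyZDeriv n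
  have hfc' : Continuous f' := continuous_hardyZDeriv (n + 1)
  set t := zeroSeq f with ht
  have hmono : Monotone t := zeroSeq_mono hfa hf0 hinf
  have htop : Tendsto t atTop atTop := tendsto_zeroSeq hfa hf0 hinf
  have hft : ∀ k, f (t k) = 0 := fun k => (zeroSeq_spec hfa hf0 hinf k).1
  -- One `κ` must serve all gaps up to `T`. The zeros below `T / log T` are discarded, and `log(T /
  -- log T) ∼ log T` makes `κ log T → 2K`.
  set κ : ℝ → ℝ := fun T => 2 * K / Real.log (T / Real.log T) with hκdef
  obtain ⟨k₀, hk₀⟩ := eventually_atTop.1 (hgap.and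
    ((Real.tendsto_log_atTop.comp htop).eventually_gt_atTop (2 * Real.pi * K)))
  have hgap' : ∀ k, k₀ ≤ k → t (k + 1) - t k < 2 * Real.pi * K / Real.log (t k) := by
    intro k hk
    obtain ⟨h1, h2⟩ := hk₀ k hk
    have hlog : 0 < Real.log (t k) := lt_trans (by positivity) h2
    rw [div_lt_iff₀ (by positivity)] at h1
    refine h1.trans_le (le_of_eq ?_)
    ring
  have hone : ∀ k, k₀ ≤ k → t (k + 1) - t k < 1 := by
    intro k hk
    have h2 : 2 * Real.pi * K < Real.log (t k) := (hk₀ k hk).2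
    have hlog : 0 < Real.log (t k) := lt_trans (by positivity) h2
    exact (hgap' k hk).trans ((div_lt_one hlog).2 h2)
  have hE : ∀ κ : ℝ, Continuous fun s => energy l v (κ * f' s) (f s) := fun κ =>
    continuous_energy (hfc'.const_mul κ) hfc
  have hP : Continuous fun s => f s ^ (2 * l) := hfc.pow _
  have hkey : ∀ᶠ b in atTop,
      C * ((∫ s in (0 : ℝ)..t b, f s ^ (2 * l))
        - ∫ s in (0 : ℝ)..2 * (t b / Real.log (t b)), f s ^ (2 * l))
      ≤ ∫ s in (0 : ℝ)..t b, energy l v (κ (t b) * f' s) (f s) := by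
    have hT0 := tendsto_div_log_atTop.comp htop
    filter_upwards [hT0.eventually_gt_atTop (t k₀), hT0.eventually_gt_atTop 1,
      htop.eventually_gt_atTop 0, (Real.tendsto_log_atTop.comp htop).eventually_gt_atTop 1]
      with b hb1 hb2 hb3 hb4
    simp only [Function.comp_apply] at hb1 hb2 hb4
    set T₀ := t b / Real.log (t b) with hT₀
    have hT₀b : T₀ ≤ t b := div_le_self hb3.le hb4.le
    have hex : ∃ k, T₀ ≤ t k := ⟨b, hT₀b⟩
    classical
    set a := Nat.find hex with ha
    have haT : T₀ ≤ t a := Nat.find_spec hex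
    have hab : a ≤ b := Nat.find_min' hex hT₀b
    have hka : k₀ < a := by
      by_contra! h
      exact absurd (hmono h) (by linarith)
    obtain ⟨j, hj⟩ : ∃ j, a = j + 1 := ⟨a - 1, by omega⟩
    have hjT : t j < T₀ := not_le.1 (Nat.find_min hex (by omega : j < a))
    -- The first zero beyond `T₀` overshoots by less than `1 < T₀`, as late gaps are shorter than
    -- `1`; hence the factor `2` in the discarded range.
    have haT2 : t a ≤ 2 * T₀ := by
      have := hone j (by omega)
      rw [← hj] at this
      linarith
    have hlogT₀ : 0 < Real.log T₀ := Real.log_pos hb2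
    have hκ : 0 < κ (t b) := by
      simp only [hκdef]
      positivity
    have hsum := energy_sum_zeros hG hl hv hC hint (hasDerivAt_hardyZDeriv n) hfc' hmono hft hκ hab
      (fun k hk => by
        refine (hgap' k (by omega)).trans_le ?_
        have h1 : Real.log T₀ ≤ Real.log (t k) :=
          Real.log_le_log (by linarith) (haT.trans (hmono hk))
        calc 2 * Real.pi * K / Real.log (t k) ≤ 2 * Real.pi * K / Real.log T₀ := by gcongr
          _ = Real.pi * κ (t b) := by
            simp only [hκdef]
            ring)
    have h0a : 0 ≤ t a := by linarith
    have h1 : 0 ≤ ∫ s in (0 : ℝ)..t a, energy l v (κ (t b) * f' s) (f s) :=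
      intervalIntegral.integral_nonneg h0a fun s _ => energy_nonneg hG hl hv _ _
    have h2 : 0 ≤ ∫ s in t a..2 * T₀, f s ^ (2 * l) :=
      intervalIntegral.integral_nonneg haT2 fun s _ => by rw [pow_mul]; positivity
    have h3 := intervalIntegral.integral_add_adjacent_intervals
      ((hE (κ (t b))).intervalIntegrable (μ := volume) 0 (t a))
      ((hE (κ (t b))).intervalIntegrable (t a) (t b))
    have h4 := intervalIntegral.integral_add_adjacent_intervals
      (hP.intervalIntegrable (μ := volume) 0 (t a)) (hP.intervalIntegrable (t a) (t b))
    have h5 := intervalIntegral.integral_add_adjacent_intervals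
      (hP.intervalIntegrable (μ := volume) 0 (t a)) (hP.intervalIntegrable (t a) (2 * T₀))
    have h6 : C * ((∫ s in (0 : ℝ)..t b, f s ^ (2 * l)) - ∫ s in (0 : ℝ)..2 * T₀, f s ^ (2 * l))
        ≤ C * ∫ s in t a..t b, f s ^ (2 * l) := by
      refine mul_le_mul_of_nonneg_left ?_ hC.le
      linarith
    linarith
  have hκlim : Tendsto (fun T => κ T * Real.log T) atTop (𝓝 (2 * K)) := by
    have h1 := (tendsto_log_div_log_log 1 one_pos).inv₀ one_ne_zero |>.const_mul (2 * K)
    rw [inv_one, mul_one] at h1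
    refine h1.congr fun T => ?_
    simp only [hκdef, one_mul, inv_div]
    ring
  have hR := (tendsto_energy_moment (v := v) hd hκlim).comp htop
  have hd0 := hd 0 (Nat.zero_le l)
  have hL1 := hd0.tendsto
  simp only [jointMoment_zero, mul_zero, add_zero] at hL1
  have hL := ((hL1.sub (tendsto_initial_moment hd0)).const_mul C).comp htop
  rw [sub_zero] at hL
  refine le_of_tendsto_of_tendsto hL hR ?_
  filter_upwards [hkey, htop.eventually_gt_atTop 1] with b hb hb1
  have hlog := Real.log_pos hb1
  have hb0 : 0 < t b := by linarith
  simp only [Function.comp_apply]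
  rw [← sub_div, ← mul_sub, ← mul_div_assoc, mul_left_comm]
  gcongr

/-! ### The equation for `𝒳` and the bound -/

theorem ratioB_self (hdl : d l ≠ 0) : ratioB l d l = 1 := by
  simp [ratioB, div_self hdl]

/-- The polynomial in the equation for `X`. -/
noncomputable def rootPoly (l : ℕ) (d v : ℕ → ℝ) (X : ℝ) : ℝ :=
  ∑ h ∈ Finset.Icc 1 l, coef l v h * ratioB l d h * X ^ h

theorem isPosRoot_iff (lam X : ℝ) : IsPosRoot l d v lam X ↔
    0 < X ∧ rootPoly l d v X = (2 * (l : ℝ) - 1) * lam * ratioB l d 0 := by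
  unfold IsPosRoot rootPoly coef
  refine and_congr_right fun _ => ?_
  rw [Finset.sum_congr rfl fun h _ => ?_]
  ring

/-- The powers of `4` in `B(h,l;n)` absorb the factor `2` in `κ log T → 2K`. -/
theorem energyLimit_eq (hdl : d l ≠ 0) {X s : ℝ} (hs : s ^ 2 = X) :
    energyLimit l d v (2 * s) = 4 ^ l * d l * rootPoly l d v X := by
  unfold energyLimit rootPoly
  rw [Finset.mul_sum]
  refine Finset.sum_congr rfl fun h _ => ?_
  rw [pow_mul, mul_pow, hs, ratioB, zpow_sub₀ (by norm_num), zpow_natCast, zpow_natCast, mul_pow]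
  norm_num
  field_simp

theorem monotoneOn_rootPoly (hG : StrictMonoOn (G l v) (Ici 0)) (hl : 1 ≤ l) (hv : v l = 1)
    (hd : ∀ h ≤ l, IsLeadingCoeff l h n (d h)) (hdl : 0 < d l) :
    MonotoneOn (rootPoly l d v) (Ici 0) := by
  intro x hx y hy hxy
  have h := energyLimit_mono hG hl hv hd
    (by positivity : 0 ≤ 2 * √x) (by gcongr : 2 * √x ≤ 2 * √y)
  rw [energyLimit_eq hdl.ne' (Real.sq_sqrt hx), energyLimit_eq hdl.ne' (Real.sq_sqrt hy)] at h
  exact le_of_mul_le_mul_left h (by positivity)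

theorem tendsto_rootPoly (hl : 1 ≤ l) (hv : v l = 1) (hdl : d l ≠ 0) :
    Tendsto (rootPoly l d v) atTop atTop := by
  refine tendsto_sum_mul_pow_atTop hl (fun h => coef l v h * ratioB l d h) (fun h => h) ?_ ?_ ?_
  · simp only [coef_self hl hv, ratioB_self hdl]
    norm_num
  · intro h hh hne
    have := Finset.mem_Icc.1 hh
    omega
  · omega

theorem continuous_rootPoly : Continuous (rootPoly l d v) := by
  unfold rootPoly
  fun_prop

theorem strictMonoOn_rootPoly (hG : StrictMonoOn (G l v) (Ici 0)) (hl : 1 ≤ l) (hv : v l = 1)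
    (hd : ∀ h ≤ l, IsLeadingCoeff l h n (d h)) (hdl : 0 < d l) :
    StrictMonoOn (rootPoly l d v) (Ici 0) := by
  have hmono := monotoneOn_rootPoly hG hl hv hd hdl
  intro x hx y hy hxy
  refine lt_of_le_of_ne (hmono hx hy hxy.le) fun heq => ?_
  -- Equal values at `x < y` would make the monotone polynomial constant on `[x, y]`, hence
  -- everywhere, but it tends to infinity.
  set p : Polynomial ℝ := ∑ h ∈ Finset.Icc 1 l,
    Polynomial.C (coef l v h * ratioB l d h) * Polynomial.X ^ h with hp
  have heval : ∀ z, p.eval z = rootPoly l d v z := fun z => by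
    simp [hp, Polynomial.eval_finsetSum, rootPoly]
  have hconst : p = Polynomial.C (rootPoly l d v x) := by
    refine Polynomial.eq_of_infinite_eval_eq _ _ ((Icc_infinite hxy).mono fun z hz => ?_)
    have hz0 : z ∈ Ici (0 : ℝ) := le_trans hx hz.1
    have h1 := hmono hx hz0 hz.1
    have h2 := hmono hz0 hy hz.2
    simp only [mem_ofPred_eq, Polynomial.eval_C, heval]
    linarith
  obtain ⟨z, hz⟩ := ((tendsto_rootPoly hl hv hdl.ne').eventually_gt_atTop
    (rootPoly l d v x)).exists
  rw [← heval z, hconst, Polynomial.eval_C] at hz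
  exact lt_irrefl _ hz

theorem existsUnique_isPosRoot (hG : StrictMonoOn (G l v) (Ici 0)) (hl : 1 ≤ l) (hv : v l = 1)
    (hd : ∀ h ≤ l, IsLeadingCoeff l h n (d h)) (hdl : 0 < d l) (hd0 : 0 < d 0) {lam : ℝ}
    (hlam : 0 < lam) : ∃! X : ℝ, IsPosRoot l d v lam X := by
  have hl2 := two_mul_sub_one_pos hl
  have hB : 0 < ratioB l d 0 := by
    unfold ratioB
    positivity
  have hc : 0 < (2 * (l : ℝ) - 1) * lam * ratioB l d 0 := by positivity
  have hzero : rootPoly l d v 0 = 0 := by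
    refine Finset.sum_eq_zero fun h hh => ?_
    have := (Finset.mem_Icc.1 hh).1
    rw [zero_pow (by omega), mul_zero]
  obtain ⟨M, hM, hM0⟩ := (((tendsto_rootPoly hl hv hdl.ne').eventually_ge_atTop
    ((2 * (l : ℝ) - 1) * lam * ratioB l d 0)).and (eventually_ge_atTop 0)).exists
  obtain ⟨X, hX, hXeq⟩ := intermediate_value_Icc hM0
    (continuous_rootPoly (l := l) (d := d) (v := v)).continuousOn ⟨by rw [hzero]; exact hc.le, hM⟩
  refine ⟨X, (isPosRoot_iff lam X).2 ⟨lt_of_le_of_ne hX.1 ?_, hXeq⟩, fun Y hY => ?_⟩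
  · rintro rfl
    rw [hzero] at hXeq
    exact hc.ne hXeq
  · obtain ⟨hY0, hYeq⟩ := (isPosRoot_iff lam Y).1 hY
    exact (strictMonoOn_rootPoly hG hl hv hd hdl).injOn hY0.le hX.1 (hYeq.trans hXeq.symm)

/-- Squaring loses the sign, so a bound on `Θ²` needs `Θ ≥ 0`; this also excludes `⊥`. -/
theorem theta_nonneg (hf0 : ∃ t, hardyZDeriv n t ≠ 0) : 0 ≤ theta n := by
  unfold theta
  split_ifs with hinf
  · refine le_limsup_of_frequently_le (Eventually.frequently ?_)
    have hfa := analyticAt_hardyZDeriv n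
    filter_upwards [(Real.tendsto_log_atTop.comp
      (tendsto_zeroSeq hfa hf0 hinf)).eventually_gt_atTop 0] with k hk
    have h1 := zeroSeq_mono hfa hf0 hinf (Nat.le_succ k)
    simp only [Function.comp_apply] at hk
    rw [EReal.coe_nonneg]
    refine div_nonneg (by simpa using h1) (by positivity)
  · exact le_top

theorem root_le_sq_of_theta_lt (hG : StrictMonoOn (G l v) (Ici 0)) (hl : 1 ≤ l) (hv : v l = 1)
    (hd : ∀ h ≤ l, IsLeadingCoeff l h n (d h)) (hdl : 0 < d l)
    (hf0 : ∃ t, hardyZDeriv n t ≠ 0) {lam X K : ℝ} (hlam : IsLambda l v lam)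
    (hX : IsPosRoot l d v lam X) (hK : 0 < K) (hθ : theta n < K) : X ≤ K ^ 2 := by
  have hl2 := two_mul_sub_one_pos hl
  have hinf : {t : ℝ | 0 ≤ t ∧ hardyZDeriv n t = 0}.Infinite := by
    by_contra h
    rw [theta, if_neg h] at hθ
    exact not_top_lt hθ
  rw [theta, if_pos hinf] at hθ
  have hgap := eventually_lt_of_limsup_lt hθ
  have hlamC : 0 < (2 * (l : ℝ) - 1) * lam := mul_pos hl2 hlam.1
  have h1 := le_energyLimit_of_gaps hG hl hv hlamC hlam.2 hd hf0 hinf hK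
    (hgap.mono fun k hk => by exact_mod_cast hk)
  rw [energyLimit_eq hdl.ne' rfl] at h1
  obtain ⟨hX0, hXeq⟩ := (isPosRoot_iff lam X).1 hX
  have hK2 : K ^ 2 ∈ Ici (0 : ℝ) := by simp only [mem_Ici]; positivity
  rw [← (strictMonoOn_rootPoly hG hl hv hd hdl).le_iff_le hX0.le hK2, hXeq]
  have h2 : (2 * (l : ℝ) - 1) * lam * ratioB l d 0
      = (2 * (l : ℝ) - 1) * lam * d 0 / (4 ^ l * d l) := by
    rw [ratioB, Nat.cast_zero, zero_sub, zpow_neg, zpow_natCast]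
    field_simp
  rw [h2, div_le_iff₀ (by positivity)]
  linarith

end HallGap

theorem lemma2 (l n : ℕ) (hl : 1 ≤ l)
    (d : ℕ → ℝ) (hd : ∀ h ≤ l, HallGap.IsLeadingCoeff l h n (d h)) (hdl : d l ≠ 0)
    (v : ℕ → ℝ) (hv : v l = 1)
    (hG : StrictMonoOn (HallGap.G l v) (Set.Ici 0)) :
    (∃! lam : ℝ, HallGap.IsLambda l v lam) ∧
      ∀ lam : ℝ, HallGap.IsLambda l v lam →
        (∃! X : ℝ, HallGap.IsPosRoot l d v lam X) ∧
          ∀ X : ℝ, HallGap.IsPosRoot l d v lam X → (X : EReal) ≤ HallGap.theta n ^ 2 := by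
  have hf0 := HallGap.exists_hardyZDeriv_ne_zero hl (hd l le_rfl) hdl
  have hdl' : 0 < d l := lt_of_le_of_ne (hd l le_rfl).nonneg hdl.symm
  have hd0 : 0 < d 0 := (hd 0 (Nat.zero_le l)).zero_pos hf0
  refine ⟨HallGap.existsUnique_isLambda hG hl, fun lam hlam =>
    ⟨HallGap.existsUnique_isPosRoot hG hl hv hd hdl' hd0 hlam.1, fun X hX => ?_⟩⟩
  have hθ0 := HallGap.theta_nonneg hf0
  have hbound : ∀ K : ℝ, 0 < K → HallGap.theta n < K → X ≤ K ^ 2 := fun K hK hθ =>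
    HallGap.root_le_sq_of_theta_lt hG hl hv hd hdl' hf0 hlam hX hK hθ
  generalize HallGap.theta n = θ at hθ0 hbound
  induction θ with
  | bot => simp at hθ0
  | top => simp [sq]
  | coe r =>
    have hr : 0 ≤ r := by exact_mod_cast hθ0
    have hX0 := hX.1
    suffices h : X ≤ r ^ 2 by exact_mod_cast h
    -- If `r² < X`, the midpoint of `r` and `√X` is an admissible `K > Θ` with `K² < X`.
    by_contra! h
    have hrX : r < √X := Real.lt_sqrt hr |>.2 h
    have hmid : r < (r + √X) / 2 := by linarith
    have h1 := hbound ((r + √X) / 2) (by linarith) (by exact_mod_cast hmid)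
    have h2 := Real.sq_sqrt hX0.le
    nlinarith
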